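/- Let $b\ge 2$ and $r\ge 2$ be integers, let $\mathbb K$ be a field of characteristic $0$ and $\mathbb L$ an algebraic field extension of $\mathbb K$. Let $M$ be the operator substituting $x^b$ for $x$ (or $t^b$ for $t$; it fixes constants). Let $\ell_0,\dots,\ell_r\in\mathbb K[x]$ have gcd $1$, with $\ell_0\ell_r\ne 0$. Consider the linear Mahler equation $$(\mathrm L)\qquad \ell_r M^r y+\dots+\ell_1 My+\ell_0 y=0$$ and the Riccati Mahler equation $$(\mathrm R)\qquad \ell_r\,u\,Mu\cdots M^{r-1}u+\dots+\ell_2\,u\,Mu+\ell_1u+\ell_0=0 .$$ **Algorithm BP.** Start with $\mathscr U=\varnothing$. For all monic $A,B\in\mathbb L[t]$ such that $A\mid\ell_0(t)$, $B\mid\ell_r(t)$ and $M^iA$, $B$ are coprime for $0\le i<r$, form $$\tilde L(t,M)=\sum_{k=0}^r\Bigl(\ell_k(t^{b^{r-1}})\prod_{j=0}^{k-1}M^{r-1+j}A\prod_{j=k}^{r-1}M^jB\Bigr)M^k=\sum_{k,j}\tilde\ell_{k,j}\,t^jM^k .$$ The upper Newton polygon of $\tilde L$ is the upper convex hull of the points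 $(b^k,j)$ with $\tilde\ell_{k,j}\ne0$; the characteristic polynomial of an edge whose end points have abscissae $b^{k_1}<b^{k_2}$ is the sum of $\tilde\ell_{k,j}X^{k-k_1}$ over the points $(b^k,j)$ on that edge; the edge is $\zeta$-admissible if $\zeta$ is a root of it. For each $\zeta\in\mathbb L$ for which there is a $\zeta$-admissible edge, let $\Delta_\zeta$ be the maximum of the integers among the opposites of the slopes of the $\zeta$-admissible edges. If $\Delta_\zeta$ exists and $\Delta_\zeta\ge0$, compute a basis $(C_1,\dots,C_s)$ of the $\mathbb L$-space of the solutions $C\in\mathbb L[t]$ of degree at most $\Delta_\zeta$ of $\tilde L(t,\zeta M)\,C=0$. If $s>0$, set $C=\sum_{i=1}^s c_iC_i$ for formal parameters $c_i$, find $u(x)\in\mathbb L(c_1,\dots,c_s)(x)$ such that $$u(t^{b^{r-1}})=\zeta\,\frac{C(t^b)}{C(t)}\,\frac{A(t^{b^{r-1}})}{B(t)},$$ and add $u$ to $\mathscr U$. Finally, while $\mathscr U$ contains two distinct elements $u^{(1)}$ and $u^{(2)}$ such that the set of rational functions parametrized by $u^{(1)}$ (letting the parameters range over the nonzero vectors over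 $\mathbb L$) is included in the one parametrized by $u^{(2)}$, remove $u^{(1)}$ from $\mathscr U$. Return $\mathscr U$. **Blocks.** Let $\mathfrak D_{\mathbb L}=\bigoplus_{\lambda\in\mathbb L\setminus\{0\}}e_\lambda P$, where $P=\bigcup_{q\ge1}\mathbb L((x^{1/q}))$ is the field of Puiseux series, $e_\lambda e_{\lambda'}=e_{\lambda\lambda'}$, $e_1=1$, and $M$ is extended by $Me_\lambda=\lambda e_\lambda$. A hypergeometric solution is a solution $y\in\mathfrak D_{\mathbb L}$ of $(\mathrm L)$ such that $My=uy$ for some $u\in\mathbb L(x)$ (unique if $y\ne0$, and then denoted $My/y$). Two nonzero hypergeometric solutions $y_1,y_2$ are similar if $y_1=qy_2$ for some nonzero $q\in\mathbb L(x)$. A block is the image under $y\mapsto My/y$ of a similarity class of nonzero hypergeometric solutions. **Theorem.** Algorithm BP executes without failure (in particular each required $u(x)$ exists and is unique) and terminates, whatever bases and whatever elements to remove are chosen. Each possible output $\mathscr U$ is finite, and: 1. each $u\in\mathscr U$, with its $s\geq 1$ parameters, can be evaluated at every point of the projective space $\mathbb P^{s-1}(\mathbb L)$, and evaluation is a bijection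 from $\mathbb P^{s-1}(\mathbb L)$ onto the set of rational functions parametrized by $u$; 2. the set of all solutions $u\in\mathbb L(x)$ of $(\mathrm R)$ is the disjoint union of the sets parametrized by the elements of $\mathscr U$; 3. the sets parametrized by the elements of $\mathscr U$ are blocks, and each block is parametrized by exactly one element of $\mathscr U$. -/

import Mathlib

noncomputable section

namespace MahlerBP

open Polynomial

/-! ### Mahler operators on polynomials and rational functions -/

/-- The data of a linear Mahler operator `L = ∑ k ≤ r, ℓ k * M ^ k` of order `r ≥ 2` and radix
`b ≥ 2` over `K`, with `ℓ 0` and `ℓ r` nonzero, and primitive (the coefficients have gcd `1`).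
Only the values `ℓ 0, …, ℓ r` are used. -/
structure MahlerEquation (K : Type*) [Field K] where
  b : ℕ
  two_le_b : 2 ≤ b
  r : ℕ
  two_le_r : 2 ≤ r
  ℓ : ℕ → K[X]
  ℓ_zero_ne : ℓ 0 ≠ 0
  ℓ_order_ne : ℓ r ≠ 0
  primitive : ∀ p : K[X], (∀ k ≤ r, p ∣ ℓ k) → IsUnit p

theorem MahlerEquation.b_pos {K : Type*} [Field K] (E : MahlerEquation K) : 0 < E.b :=
  lt_of_lt_of_le Nat.zero_lt_two E.two_le_b

theorem expand_nonZeroDivisors (R : Type*) [CommRing R] [IsDomain R] {b : ℕ} (hb : 0 < b) :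
    nonZeroDivisors R[X] ≤ (nonZeroDivisors R[X]).comap (expand R b) := by
  intro p hp
  rw [Submonoid.mem_comap]
  rw [mem_nonZeroDivisors_iff_ne_zero] at hp ⊢
  exact (expand_ne_zero hb).2 hp

/-- The Mahler operator `u(x) ↦ u(x ^ b)` on the fraction field of `R[x]`. -/
def mahler (R : Type*) [CommRing R] [IsDomain R] {b : ℕ} (hb : 0 < b) :
    RatFunc R →+* RatFunc R :=
  RatFunc.mapRingHom (expand R b) (expand_nonZeroDivisors R hb)

section Equation

variable {K : Type*} [Field K] (E : MahlerEquation K)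
variable (L : Type*) [Field L] [Algebra K L]

/-- The coefficient `ℓ k`, viewed over `L`. -/
def MahlerEquation.coeff (k : ℕ) : L[X] := (E.ℓ k).map (algebraMap K L)

/-- The Mahler operator on `L(x)`. -/
def MahlerEquation.M : RatFunc L →+* RatFunc L := mahler L E.b_pos

/-- The solutions `u` in `L(x)` of the Riccati Mahler equation
`∑ k ≤ r, ℓ k * (u * M u * ⋯ * M ^ (k - 1) u) = 0`. -/
def MahlerEquation.riccatiSolutions : Set (RatFunc L) :=
  {u | ∑ k ∈ Finset.range (E.r + 1),
    algebraMap L[X] (RatFunc L) (E.coeff L k) * ∏ j ∈ Finset.range k, (E.M L)^[j] u = 0}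

end Equation

/-! ### Formal parametrizations -/

/-- A rational function `u ∈ L(c₁, …, cₛ)(x)` in `x` and in formal parameters `c₁, …, cₛ`,
together with the number `s` of parameters.
The field `L(c₁, …, cₛ)(x)` is realized as the fraction field of `L[c₁, …, cₛ][x]`. -/
abbrev Param (L : Type*) [Field L] : Type _ := Σ s : ℕ, RatFunc (MvPolynomial (Fin s) L)

/-- `v ∈ L(x)` is the value of the parametrized rational function `p` at `γ ∈ L ^ s`: one can
write `p` as `P / Q` with `P` and `Q` in `L[c₁, …, cₛ][x]` such that `Q(γ, x) ≠ 0` and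
`v = P(γ, x) / Q(γ, x)`. -/
def Param.IsValueAt {L : Type*} [Field L] (p : Param L) (γ : Fin p.1 → L) (v : RatFunc L) :
    Prop :=
  ∃ P Q : (MvPolynomial (Fin p.1) L)[X],
    Q.map (MvPolynomial.eval γ) ≠ 0 ∧
    p.2 = algebraMap _ (RatFunc (MvPolynomial (Fin p.1) L)) P / algebraMap _ _ Q ∧
    v = algebraMap L[X] (RatFunc L) (P.map (MvPolynomial.eval γ)) /
      algebraMap L[X] (RatFunc L) (Q.map (MvPolynomial.eval γ))

/-- The set of rational functions that `p` parametrizes, as the parameters range over the nonzero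
vectors of `L ^ s`. -/
def Param.image {L : Type*} [Field L] (p : Param L) : Set (RatFunc L) :=
  {v | ∃ γ : Fin p.1 → L, γ ≠ 0 ∧ p.IsValueAt γ v}

/-- Evaluation of `p` is everywhere defined on the projective space `ℙ ^ (s - 1) (L)`, and it is
a bijection from this projective space onto the image of `p`. -/
def Param.IsBijectiveParametrization {L : Type*} [Field L] (p : Param L) : Prop :=
  0 < p.1 ∧
  ∃ φ : Projectivization L (Fin p.1 → L) → RatFunc L,
    (∀ (γ : Fin p.1 → L) (hγ : γ ≠ 0), p.IsValueAt γ (φ (Projectivization.mk L γ hγ))) ∧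
    Set.BijOn φ Set.univ p.image

/-! ### Upper Newton polygons -/

section Newton

variable {L : Type*} [Field L]

/-- For the operator `∑ k ≤ r, p k * M ^ k`, the points of the Newton polygon are the
`(b ^ k, j)` with nonzero coefficient `(p k).coeff j`.
The line `y = m * x + h` carries an edge of their upper convex hull, with end points of abscissae
`b ^ k₁ < b ^ k₂`: no point is above this line, and the extreme points on this line have
abscissae `b ^ k₁` and `b ^ k₂`. -/
structure IsUpperEdge (b r : ℕ) (p : ℕ → L[X]) (k₁ k₂ : ℕ) (m h : ℚ) : Prop where
  lt : k₁ < k₂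
  le : k₂ ≤ r
  below : ∀ k ≤ r, ∀ j ∈ (p k).support, (j : ℚ) ≤ m * (b : ℚ) ^ k + h
  left : ∃ j ∈ (p k₁).support, (j : ℚ) = m * (b : ℚ) ^ k₁ + h
  right : ∃ j ∈ (p k₂).support, (j : ℚ) = m * (b : ℚ) ^ k₂ + h
  between : ∀ k ≤ r, ∀ j ∈ (p k).support, (j : ℚ) = m * (b : ℚ) ^ k + h → k₁ ≤ k ∧ k ≤ k₂

open Classical in
/-- The characteristic polynomial of an edge: the sum of the `(p k).coeff j * X ^ (k - k₁)` over
the points `(b ^ k, j)` of the edge. -/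
def edgeCharPoly (b : ℕ) (p : ℕ → L[X]) (k₁ k₂ : ℕ) (m h : ℚ) : L[X] :=
  ∑ k ∈ Finset.Icc k₁ k₂,
    ∑ j ∈ (p k).support with ((j : ℕ) : ℚ) = m * (b : ℚ) ^ k + h,
      C ((p k).coeff j) * X ^ (k - k₁)

/-- The upper Newton polygon has a `ζ`-admissible edge of slope `m`: an edge whose
characteristic polynomial has `ζ` as a root. -/
def HasAdmissibleEdge (b r : ℕ) (p : ℕ → L[X]) (ζ : L) (m : ℚ) : Prop :=
  ∃ (k₁ k₂ : ℕ) (h : ℚ), IsUpperEdge b r p k₁ k₂ m h ∧ (edgeCharPoly b p k₁ k₂ m h).IsRoot ζ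

/-- The set of the roots in `L` of the characteristic polynomials of the edges of the upper Newton
polygon. -/
def upperRoots (b r : ℕ) (p : ℕ → L[X]) : Set L :=
  {ζ | ∃ m : ℚ, HasAdmissibleEdge b r p ζ m}

/-- For `P = ∑ k ≤ r, p k * M ^ k`, the map `C(t) ↦ P(t, ζ M) C(t) =
∑ k ≤ r, p k(t) * ζ ^ k * C(t ^ (b ^ k))`. -/
def twistedOperator (b r : ℕ) (p : ℕ → L[X]) (ζ : L) : L[X] →ₗ[L] L[X] :=
  ∑ k ∈ Finset.range (r + 1),
    (LinearMap.mulLeft L (p k * C (ζ ^ k))) ∘ₗ (expand L (b ^ k)).toLinearMap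

end Newton

/-! ### The algorithm -/

section Algorithm

variable {K : Type*} [Field K] (E : MahlerEquation K)
variable (L : Type*) [Field L] [Algebra K L]

/-- The coefficient of `M ^ k` in the auxiliary operator attached to `A` and `B`:
`M ^ (r - 1) ℓ k * ∏ j < k, M ^ (r - 1 + j) A * ∏ k ≤ j < r, M ^ j B`. -/
def auxCoeff (A B : L[X]) (k : ℕ) : L[X] :=
  expand L (E.b ^ (E.r - 1)) (E.coeff L k) *
    (∏ j ∈ Finset.range k, expand L (E.b ^ (E.r - 1 + j)) A) *
    ∏ j ∈ Finset.Ico k E.r, expand L (E.b ^ j) B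

/-- The tuples `(A, B, ζ)`, together with the associated degree bound `Δ`, for which the main loop
of the algorithm looks for solutions `C`. -/
structure Iteration where
  A : L[X]
  B : L[X]
  ζ : L
  Δ : ℕ
  A_monic : A.Monic
  A_dvd : A ∣ E.coeff L 0
  B_monic : B.Monic
  B_dvd : B ∣ E.coeff L E.r
  coprime : ∀ i < E.r, IsCoprime (expand L (E.b ^ i) A) B
  ζ_mem : ζ ∈ upperRoots E.b E.r (auxCoeff E L A B)
  /-- `Δ` is the maximum of the integers among the opposites of the slopes of the
  `ζ`-admissible edges (and it is nonnegative, as `Δ : ℕ`). -/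
  Δ_greatest : IsGreatest
    {d : ℤ | HasAdmissibleEdge E.b E.r (auxCoeff E L A B) ζ (-(d : ℚ))} (Δ : ℤ)

variable {E L}

/-- The space of the `C ∈ L[t]` of degree at most `Δ` such that `(auxiliary operator)(t, ζ M) C = 0`. -/
def Iteration.solSpace (i : Iteration E L) : Submodule L L[X] :=
  degreeLE L (i.Δ : WithBot ℕ) ⊓
    LinearMap.ker (twistedOperator E.b E.r (auxCoeff E L i.A i.B) i.ζ)

/-- The dimension of this space of solutions. -/
def Iteration.dim (i : Iteration E L) : ℕ := Module.finrank L i.solSpace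

/-- The polynomial `C = ∑ i, cᵢ * Cᵢ` for formal parameters `cᵢ`. -/
def genericSolution {s : ℕ} (Cs : Fin s → L[X]) : (MvPolynomial (Fin s) L)[X] :=
  ∑ i, C (MvPolynomial.X i) * (Cs i).map (MvPolynomial.C)

/-- The formal rational function
`ζ * (C(t ^ b) / C(t)) * (A(t ^ (b ^ (r - 1))) / B(t))` in `L(c₁, …, cₛ)(t)`, with
`C = ∑ i, cᵢ * Cᵢ`. -/
def Iteration.formalFunction (i : Iteration E L) {s : ℕ} (Cs : Fin s → L[X]) :
    RatFunc (MvPolynomial (Fin s) L) :=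
  RatFunc.C (MvPolynomial.C i.ζ) *
    (algebraMap _ _ (expand (MvPolynomial (Fin s) L) E.b (genericSolution Cs)) /
      algebraMap _ _ (genericSolution Cs)) *
    (algebraMap _ _ ((expand L (E.b ^ (E.r - 1)) i.A).map (MvPolynomial.C (σ := Fin s))) /
      algebraMap _ _ (i.B.map (MvPolynomial.C (σ := Fin s))))

variable (E L)

/-- A choice of the bases computed in the main loop. -/
abbrev BasisChoice : Type _ := ∀ i : Iteration E L, Module.Basis (Fin i.dim) L i.solSpace

variable {E L}

/-- `u(x)` is identified from the formal function `ũ(t)` of the iteration by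
`u(t ^ (b ^ (r - 1))) = ũ(t)`. -/
def IsIdentified (β : BasisChoice E L) (i : Iteration E L)
    (u : RatFunc (MvPolynomial (Fin i.dim) L)) : Prop :=
  (mahler (MvPolynomial (Fin i.dim) L) E.b_pos)^[E.r - 1] u =
    i.formalFunction fun j => (β i j : L[X])

/-- The set of parametrizations gathered by the main loop. -/
def candidates (β : BasisChoice E L) : Set (Param L) :=
  {p | ∃ (i : Iteration E L) (u : RatFunc (MvPolynomial (Fin i.dim) L)),
    0 < i.dim ∧ IsIdentified β i u ∧ p = ⟨i.dim, u⟩}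

/-- One pass through the cleaning loop: if `𝒰` contains two distinct elements `p` and `q` with
inclusion of `p` in `q`, remove `p` from `𝒰`. -/
def CleaningStep (𝒰 𝒰' : Set (Param L)) : Prop :=
  ∃ p ∈ 𝒰, ∃ q ∈ 𝒰, p ≠ q ∧ p.image ⊆ q.image ∧ 𝒰' = 𝒰 \ {p}

variable (E L)

/-- `𝒰` is a possible output of the algorithm: for some choice of the bases, it is obtained from
the set gathered by the main loop by running the cleaning loop until it stops. -/
def IsOutput (𝒰 : Set (Param L)) : Prop :=
  ∃ β : BasisChoice E L,
    Relation.ReflTransGen CleaningStep (candidates β) 𝒰 ∧ ¬ ∃ 𝒰', CleaningStep 𝒰 𝒰'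

/-- The algorithm executes without failure and terminates: the main loop is finite, the required
bases exist, each identification of a rational function `u(x)` with `u(t ^ (b ^ (r - 1))) = ũ(t)`
succeeds with a unique result, and the cleaning loop cannot be run forever, whatever choices are
made. -/
def Terminates : Prop :=
  Finite (Iteration E L) ∧
  (∀ i : Iteration E L, Module.Finite L i.solSpace) ∧
  Nonempty (BasisChoice E L) ∧
  (∀ (β : BasisChoice E L) (i : Iteration E L), 0 < i.dim → ∃! u, IsIdentified β i u) ∧
  (∀ β : BasisChoice E L,
    Acc (fun 𝒰' 𝒰 : Set (Param L) => CleaningStep 𝒰 𝒰') (candidates β))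

end Algorithm

/-! ### Puiseux series, the difference ring of generalized series, and blocks -/

section Blocks

/-- The group homomorphism `n ↦ n / q` from `ℤ` to `ℚ`. -/
def divHom (q : ℕ) : ℤ →+ ℚ where
  toFun n := (n : ℚ) / q
  map_zero' := by simp
  map_add' m n := by push_cast; ring

theorem divHom_le {q : ℕ} (hq : 0 < q) (m n : ℤ) : divHom q m ≤ divHom q n ↔ m ≤ n := by
  have h : (0 : ℚ) < q := by exact_mod_cast hq
  change (m : ℚ) / q ≤ (n : ℚ) / q ↔ m ≤ n
  rw [div_le_div_iff_of_pos_right h]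
  exact_mod_cast Iff.rfl

theorem divHom_injective {q : ℕ} (hq : 0 < q) : Function.Injective (divHom q) := fun m n h =>
  le_antisymm ((divHom_le hq m n).1 h.le) ((divHom_le hq n m).1 h.ge)

theorem embDomain_embDomain {Γ₁ Γ₂ Γ₃ L : Type*} [PartialOrder Γ₁] [PartialOrder Γ₂]
    [PartialOrder Γ₃] [Zero L] {f : Γ₁ ↪o Γ₂} {g : Γ₂ ↪o Γ₃} {h : Γ₁ ↪o Γ₃}
    (hfg : ∀ a, g (f a) = h a) (x : HahnSeries Γ₁ L) :
    HahnSeries.embDomain g (HahnSeries.embDomain f x) = HahnSeries.embDomain h x := by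
  ext a
  by_cases ha : a ∈ Set.range g
  · obtain ⟨b, rfl⟩ := ha
    rw [HahnSeries.embDomain_coeff]
    by_cases hb : b ∈ Set.range f
    · obtain ⟨c, rfl⟩ := hb
      rw [HahnSeries.embDomain_coeff, hfg, HahnSeries.embDomain_coeff]
    · rw [HahnSeries.embDomain_of_notMem_range hb, HahnSeries.embDomain_of_notMem_range]
      rintro ⟨c, hc⟩
      exact hb ⟨c, g.injective ((hfg c).trans hc)⟩
  · rw [HahnSeries.embDomain_of_notMem_range ha, HahnSeries.embDomain_of_notMem_range]
    rintro ⟨c, hc⟩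
    exact ha ⟨f c, (hfg c).trans hc⟩

variable (L : Type*) [Field L]

/-- The embedding `f(x) ↦ f(x ^ (1 / q))` of Laurent series into series with rational
exponents; its range is `L((x ^ (1 / q)))`. -/
def ramify {q : ℕ} (hq : 0 < q) : LaurentSeries L →+* HahnSeries ℚ L :=
  HahnSeries.embDomainRingHom (divHom q) (divHom_injective hq) (divHom_le hq)

theorem ramify_range_le {q q' : ℕ} (hq : 0 < q) (hq' : 0 < q') :
    (ramify L hq).fieldRange ≤ (ramify L (Nat.mul_pos hq hq')).fieldRange := by
  rintro _ ⟨f, rfl⟩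
  have hle : ∀ m n : ℤ, AddMonoidHom.mulLeft (q' : ℤ) m ≤ AddMonoidHom.mulLeft (q' : ℤ) n ↔
      m ≤ n := fun m n => mul_le_mul_iff_right₀ (by exact_mod_cast hq')
  have hinj : Function.Injective (AddMonoidHom.mulLeft (q' : ℤ)) := fun m n h =>
    le_antisymm ((hle m n).1 h.le) ((hle n m).1 h.ge)
  refine ⟨HahnSeries.embDomainRingHom (AddMonoidHom.mulLeft (q' : ℤ)) hinj hle f, ?_⟩
  refine embDomain_embDomain (fun n => ?_) f
  have hq0 : (q : ℚ) ≠ 0 := by exact_mod_cast hq.ne'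
  have hq0' : (q' : ℚ) ≠ 0 := by exact_mod_cast hq'.ne'
  change (((q' : ℤ) * n : ℤ) : ℚ) / ((q * q' : ℕ) : ℚ) = (n : ℚ) / q
  push_cast
  field_simp

theorem ramify_range_le' {q q' : ℕ} (hq : 0 < q) (hq' : 0 < q') :
    (ramify L hq').fieldRange ≤ (ramify L (Nat.mul_pos hq hq')).fieldRange := by
  have h : ∀ {n m : ℕ} (hn : 0 < n) (hm : 0 < m), n = m →
      (ramify L hn).fieldRange ≤ (ramify L hm).fieldRange := by
    rintro n _ hn hm rfl
    exact le_rfl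
  exact (ramify_range_le L hq' hq).trans (h _ _ (Nat.mul_comm q' q))

/-- The field of Puiseux series over `L`, the union of the `L((x ^ (1 / q)))` for `q ≥ 1`. -/
def puiseux : Subfield (HahnSeries ℚ L) where
  carrier := {f | ∃ (q : ℕ) (hq : 0 < q), f ∈ (ramify L hq).fieldRange}
  mul_mem' := by
    rintro f g ⟨q, hq, hf⟩ ⟨q', hq', hg⟩
    exact ⟨q * q', Nat.mul_pos hq hq',
      mul_mem (ramify_range_le L hq hq' hf) (ramify_range_le' L hq hq' hg)⟩
  one_mem' := ⟨1, Nat.one_pos, one_mem _⟩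
  add_mem' := by
    rintro f g ⟨q, hq, hf⟩ ⟨q', hq', hg⟩
    exact ⟨q * q', Nat.mul_pos hq hq',
      add_mem (ramify_range_le L hq hq' hf) (ramify_range_le' L hq hq' hg)⟩
  zero_mem' := ⟨1, Nat.one_pos, zero_mem _⟩
  neg_mem' := by
    rintro f ⟨q, hq, hf⟩
    exact ⟨q, hq, neg_mem hf⟩
  inv_mem' := by
    rintro f ⟨q, hq, hf⟩
    exact ⟨q, hq, inv_mem hf⟩

/-- The field of Puiseux series, as a type. -/
abbrev Puiseux : Type _ := puiseux L

/-- The inclusion of `L(x)` into `L((x))`. -/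
def ratToLaurent : RatFunc L →+* LaurentSeries L :=
  IsFractionRing.lift (FaithfulSMul.algebraMap_injective L[X] (LaurentSeries L))

/-- The inclusion of `L(x)` into the field of Puiseux series. -/
def ratToPuiseux : RatFunc L →+* Puiseux L :=
  ((ramify L Nat.one_pos).comp (ratToLaurent L)).codRestrict (puiseux L)
    fun u => ⟨1, Nat.one_pos, ⟨ratToLaurent L u, rfl⟩⟩

theorem mulLeft_le {b : ℕ} (hb : 0 < b) (x y : ℚ) :
    AddMonoidHom.mulLeft (b : ℚ) x ≤ AddMonoidHom.mulLeft (b : ℚ) y ↔ x ≤ y :=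
  mul_le_mul_iff_right₀ (by exact_mod_cast hb)

theorem mulLeft_injective {b : ℕ} (hb : 0 < b) :
    Function.Injective (AddMonoidHom.mulLeft (b : ℚ)) := fun x y h =>
  le_antisymm ((mulLeft_le hb x y).1 h.le) ((mulLeft_le hb y x).1 h.ge)

/-- The Mahler operator `f(x) ↦ f(x ^ b)` on series with rational exponents. -/
def mahlerHahn {b : ℕ} (hb : 0 < b) : HahnSeries ℚ L →+* HahnSeries ℚ L :=
  HahnSeries.embDomainRingHom (AddMonoidHom.mulLeft (b : ℚ)) (mulLeft_injective hb) (mulLeft_le hb)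

theorem mahlerHahn_mem {b : ℕ} (hb : 0 < b) (f : Puiseux L) :
    mahlerHahn L hb (f : HahnSeries ℚ L) ∈ puiseux L := by
  obtain ⟨_, q, hq, f, rfl⟩ := f
  have hle : ∀ m n : ℤ, AddMonoidHom.mulLeft (b : ℤ) m ≤ AddMonoidHom.mulLeft (b : ℤ) n ↔
      m ≤ n := fun m n => mul_le_mul_iff_right₀ (by exact_mod_cast hb)
  have hinj : Function.Injective (AddMonoidHom.mulLeft (b : ℤ)) := fun m n h =>
    le_antisymm ((hle m n).1 h.le) ((hle n m).1 h.ge)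
  refine ⟨q, hq, HahnSeries.embDomainRingHom (AddMonoidHom.mulLeft (b : ℤ)) hinj hle f, ?_⟩
  have hcomp : ∀ n : ℤ, divHom q (AddMonoidHom.mulLeft (b : ℤ) n) =
      AddMonoidHom.mulLeft (b : ℚ) (divHom q n) := by
    intro n
    change (((b : ℤ) * n : ℤ) : ℚ) / q = (b : ℚ) * ((n : ℚ) / q)
    push_cast
    ring
  refine (embDomain_embDomain (h := ⟨⟨fun n : ℤ => AddMonoidHom.mulLeft (b : ℚ) (divHom q n),
    (mulLeft_injective hb).comp (divHom_injective hq)⟩,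
    (mulLeft_le hb _ _).trans (divHom_le hq _ _)⟩) hcomp f).trans ?_
  exact (embDomain_embDomain (fun _ => rfl) f).symm

/-- The Mahler operator on the field of Puiseux series. -/
def mahlerPuiseux {b : ℕ} (hb : 0 < b) : Puiseux L →+* Puiseux L :=
  ((mahlerHahn L hb).comp (puiseux L).subtype).codRestrict (puiseux L) (mahlerHahn_mem L hb)

/-- The ring `⨁ e_λ * Puiseux(L)` for `λ ∈ Lˣ`, with `e_λ * e_μ = e_(λ * μ)` and `e_1 = 1`: the
group algebra of `Lˣ` over the field of Puiseux series. -/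
abbrev GenSeries : Type _ := MonoidAlgebra (Puiseux L) Lˣ

/-- The inclusion of `L(x)` into the ring of generalized series. -/
def ratToGenSeries : RatFunc L →+* GenSeries L :=
  MonoidAlgebra.singleOneRingHom.comp (ratToPuiseux L)

/-- A constant of `L`, as a Puiseux series. -/
def constPuiseux : L →+* Puiseux L := (ratToPuiseux L).comp RatFunc.C

/-- The Mahler operator on the ring of generalized series: it is the given one on Puiseux series,
and `M e_λ = λ * e_λ`. -/
def mahlerGenSeries {b : ℕ} (hb : 0 < b) : GenSeries L →+* GenSeries L :=
  MonoidAlgebra.liftNCRingHom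
    (MonoidAlgebra.singleOneRingHom.comp (mahlerPuiseux L hb))
    { toFun := fun a => MonoidAlgebra.single a (constPuiseux L (a : L))
      map_one' := by
        rw [Units.val_one, map_one]
        rfl
      map_mul' := fun a c => by
        rw [MonoidAlgebra.single_mul_single, Units.val_mul, map_mul] }
    fun _ _ => mul_comm _ _

variable {L}
variable {K : Type*} [Field K] (E : MahlerEquation K)

/-- `y` is a solution of the linear Mahler equation `∑ k ≤ r, ℓ k * M ^ k y = 0`. -/
def IsLinearSolution [Algebra K L] (y : GenSeries L) : Prop :=
  ∑ k ∈ Finset.range (E.r + 1),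
    ratToGenSeries L (algebraMap L[X] (RatFunc L) (E.coeff L k)) *
      (mahlerGenSeries L E.b_pos)^[k] y = 0

/-- `M y = u y`, for a rational function `u`. -/
def HasQuotient (u : RatFunc L) (y : GenSeries L) : Prop :=
  mahlerGenSeries L E.b_pos y = ratToGenSeries L u * y

variable (L)

/-- The nonzero `L(x)`-hypergeometric solutions of the linear Mahler equation. -/
def hypergeometricSolutions [Algebra K L] : Set (GenSeries L) :=
  {y | y ≠ 0 ∧ IsLinearSolution E y ∧ ∃ u : RatFunc L, HasQuotient E u y}

variable {L}

/-- `L(x)`-similarity. -/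
def Similar (y₁ y₂ : GenSeries L) : Prop :=
  ∃ q : RatFunc L, q ≠ 0 ∧ y₁ = ratToGenSeries L q * y₂

variable (L)

/-- The blocks: the images under `y ↦ M y / y` of the similarity classes of nonzero hypergeometric
solutions of the linear Mahler equation. -/
def blocks [Algebra K L] : Set (Set (RatFunc L)) :=
  {𝔅 | ∃ y₀ ∈ hypergeometricSolutions L E,
    𝔅 = {u | ∃ y ∈ hypergeometricSolutions L E, Similar y y₀ ∧ HasQuotient E u y}}

end Blocks

end MahlerBP

end

/-!
Write a solution `u` of the Riccati equation in Gosper–Petkovšek form: up to a power of `M`, it is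
`ζ * (M c / c) * (A / B)` with `A` and `B` monic, and coprimality forces `A ∣ ℓ₀` and `B ∣ ℓᵣ`.
The Riccati equation then says that `c` is a polynomial solution of a linear Mahler equation, in
which cancelling the terms of highest degree makes `ζ` the root of an edge of the upper Newton
polygon and bounds `deg c`. So the finitely many iterations produce every solution.

Call two solutions equivalent if they differ by a factor `M q / q`. Each iteration stays inside one
equivalence class, because its values have this property after applying a power of `M` and the
property descends. For a fixed `u₀`, the `q` such that `u₀ * (M q / q)` is a solution form, with
`0`, an `L`-vector space, and those reached by a given iteration form, with `0`, a subspace. Since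
a vector space over an infinite field is not a finite union of proper subspaces, some iteration
produces the whole class of `u₀`, and the cleaning loop keeps exactly one parametrization per
class.

Finally, every equation `M y = u * y` with `u ≠ 0` has a nonzero solution in generalized series, and
multiplying `y` by `q` multiplies `u` by `M q / q`, so the blocks are exactly these classes.
-/

noncomputable section

namespace MahlerBP

/-! ### Iterates of ring endomorphisms -/

theorem pow_add_apply {R : Type*} [Semiring R] (σ : R →+* R) (i j : ℕ) (x : R) :
    (σ ^ (i + j)) x = (σ ^ i) ((σ ^ j) x) := by
  rw [pow_add, RingHom.mul_def, RingHom.comp_apply]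

theorem pow_succ_apply {R : Type*} [Semiring R] (σ : R →+* R) (i : ℕ) (x : R) :
    (σ ^ (i + 1)) x = σ ((σ ^ i) x) := by
  rw [add_comm, pow_add_apply, pow_one]

theorem pow_succ_apply' {R : Type*} [Semiring R] (σ : R →+* R) (i : ℕ) (x : R) :
    (σ ^ (i + 1)) x = (σ ^ i) (σ x) := by
  rw [pow_add_apply, pow_one]

theorem pow_apply_of_map_eq_self {R : Type*} [Semiring R] {σ : R →+* R} {z : R} (hz : σ z = z)
    (i : ℕ) : (σ ^ i) z = z := by
  induction i with
  | zero => rfl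
  | succ i ih => rw [pow_succ_apply, ih, hz]

section Descent

variable {F : Type*} [Field F] {σ : F →+* F}

variable (σ) in
theorem fieldRange_pow_anti {i j : ℕ} (h : i ≤ j) : (σ ^ j).fieldRange ≤ (σ ^ i).fieldRange := by
  rintro _ ⟨x, rfl⟩
  obtain ⟨k, rfl⟩ := Nat.exists_eq_add_of_le h
  exact ⟨(σ ^ k) x, (pow_add_apply σ i k x).symm⟩

theorem pow_succ_mem_fieldRange {j : ℕ} (i : ℕ) {x : F} (hx : x ∈ (σ ^ j).fieldRange) :
    (σ ^ (i + 1)) x ∈ (σ ^ (j + 1)).fieldRange := by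
  obtain ⟨y, rfl⟩ := hx
  exact ⟨(σ ^ i) y, by rw [← pow_add_apply, ← pow_add_apply]; congr 2; omega⟩

theorem mem_fieldRange_pow_of_forall_succ {m : ℕ} {x : F}
    (h : ∀ j < m, x ∈ (σ ^ j).fieldRange → x ∈ (σ ^ (j + 1)).fieldRange) :
    x ∈ (σ ^ m).fieldRange := by
  induction m with
  | zero => exact ⟨x, rfl⟩
  | succ m ih => exact h m m.lt_succ_self (ih fun j hj => h j (hj.trans m.lt_succ_self))

theorem mem_fieldRange_pow_of_map_div_mem {m : ℕ} {w : F} (h : σ w / w ∈ (σ ^ m).fieldRange) :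
    w ∈ (σ ^ m).fieldRange := by
  rcases eq_or_ne w 0 with rfl | hw
  · exact zero_mem _
  refine mem_fieldRange_pow_of_forall_succ fun j hj hwj => ?_
  have hσw : σ w ∈ (σ ^ (j + 1)).fieldRange := pow_succ_mem_fieldRange 0 hwj
  have hquot : σ w / (σ w / w) = w := div_div_cancel₀ ((map_ne_zero σ).2 hw)
  exact hquot ▸ div_mem hσw (fieldRange_pow_anti σ hj h)

theorem exists_eq_map_div_of_pow_eq {m : ℕ} {x w : F} (hw : w ≠ 0) (h : (σ ^ m) x = σ w / w) :
    ∃ q, q ≠ 0 ∧ (σ ^ m) q = w ∧ x = σ q / q := by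
  obtain ⟨q, rfl⟩ := mem_fieldRange_pow_of_map_div_mem ⟨x, h⟩
  refine ⟨q, (map_ne_zero _).1 hw, rfl, (σ ^ m).injective ?_⟩
  rw [h, map_div₀, ← pow_succ_apply, pow_succ_apply']

end Descent

/-! ### Riccati expressions -/

/-- The left-hand side `∑ k ≤ r, a k * (u * σ u * ⋯ * σ ^ (k - 1) u)` of the Riccati equation of the
operator `∑ k ≤ r, a k * σ ^ k`. -/
def riccati {F : Type*} [CommSemiring F] (σ : F →+* F) (r : ℕ) (a : ℕ → F) (u : F) : F :=
  ∑ k ∈ Finset.range (r + 1), a k * ∏ j ∈ Finset.range k, (σ ^ j) u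

theorem riccati_eq_add_mul {F : Type*} [CommSemiring F] (σ : F →+* F) (r : ℕ) (a : ℕ → F) (u : F) :
    riccati σ r a u =
      (∑ k ∈ Finset.range r, a (k + 1) * ∏ j ∈ Finset.range k, (σ ^ (j + 1)) u) * u + a 0 := by
  simp only [riccati, Finset.sum_range_succ', Finset.prod_range_succ', Finset.prod_range_zero,
    pow_zero, RingHom.coe_one, id, mul_one, Finset.sum_mul, mul_assoc]

theorem riccati_map {F G : Type*} [CommSemiring F] [CommSemiring G] {σ : F →+* F} {τ : G →+* G}
    {f : F →+* G} (hf : ∀ x, f (σ x) = τ (f x)) (r : ℕ) (a : ℕ → F) (u : F) :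
    f (riccati σ r a u) = riccati τ r (fun k => f (a k)) (f u) := by
  have hpow (j : ℕ) : f ((σ ^ j) u) = (τ ^ j) (f u) := by
    induction j with
    | zero => rfl
    | succ j ih => rw [pow_succ_apply, hf, ih, pow_succ_apply]
  simp only [riccati, map_sum, map_mul, map_prod, hpow]

section Riccati

variable {F : Type*} [Field F] {σ : F →+* F}

theorem mem_fieldRange_pow_of_riccati_eq_zero {m r : ℕ} {a : ℕ → F} (ha : a 0 ≠ 0) {u : F}
    (h : riccati σ r (fun k => (σ ^ m) (a k)) u = 0) : u ∈ (σ ^ m).fieldRange := by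
  refine mem_fieldRange_pow_of_forall_succ fun j hj hu => ?_
  rw [riccati_eq_add_mul, add_eq_zero_iff_eq_neg] at h
  have ha' : ∀ k, (σ ^ m) (a k) ∈ (σ ^ (j + 1)).fieldRange := fun k =>
    fieldRange_pow_anti σ hj ⟨a k, rfl⟩
  have hS := sum_mem fun k (_ : k ∈ Finset.range r) => mul_mem (ha' (k + 1))
    (prod_mem fun i (_ : i ∈ Finset.range k) => pow_succ_mem_fieldRange i hu)
  have hne : -(σ ^ m) (a 0) ≠ 0 := neg_ne_zero.2 ((map_ne_zero _).2 ha)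
  rw [eq_div_of_mul_eq (left_ne_zero_of_mul (h ▸ hne)) ((mul_comm _ _).trans h)]
  exact div_mem (neg_mem (ha' 0)) hS

theorem prod_pow_mul_map_div (u q : F) (k : ℕ) :
    (∏ j ∈ Finset.range k, (σ ^ j) (u * (σ q / q))) * q =
      (∏ j ∈ Finset.range k, (σ ^ j) u) * (σ ^ k) q := by
  rcases eq_or_ne q 0 with rfl | hq
  · simp only [map_zero, mul_zero]
  induction k with
  | zero => rfl
  | succ k ih =>
    have hk : (σ ^ k) q ≠ 0 := (map_ne_zero (σ ^ k)).2 hq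
    rw [Finset.prod_range_succ, Finset.prod_range_succ, mul_right_comm, ih, map_mul, map_div₀,
      ← pow_succ_apply']
    field_simp

theorem riccati_mul_map_div (r : ℕ) (a : ℕ → F) (u q : F) :
    riccati σ r a (u * (σ q / q)) * q =
      ∑ k ∈ Finset.range (r + 1), a k * (∏ j ∈ Finset.range k, (σ ^ j) u) * (σ ^ k) q := by
  simp only [riccati, Finset.sum_mul, mul_assoc, prod_pow_mul_map_div]

theorem riccati_petkovsekForm {A B c z : F} (hB : B ≠ 0) (hz : σ z = z) (m r : ℕ) (a : ℕ → F) :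
    riccati σ r (fun k => (σ ^ m) (a k)) (z * ((σ ^ m) A / B) * (σ c / c)) * c *
        ∏ j ∈ Finset.range r, (σ ^ j) B =
      ∑ k ∈ Finset.range (r + 1), (σ ^ m) (a k) * (∏ j ∈ Finset.range k, (σ ^ (m + j)) A) *
        (∏ j ∈ Finset.Ico k r, (σ ^ j) B) * z ^ k * (σ ^ k) c := by
  rw [riccati_mul_map_div, Finset.sum_mul]
  refine Finset.sum_congr rfl fun k hk => ?_
  have hprod : ∏ j ∈ Finset.range k, (σ ^ j) (z * ((σ ^ m) A / B)) =
      z ^ k * ((∏ j ∈ Finset.range k, (σ ^ (m + j)) A) / ∏ j ∈ Finset.range k, (σ ^ j) B) := by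
    simp only [map_mul, map_div₀, pow_apply_of_map_eq_self hz, ← pow_add_apply, add_comm _ m,
      Finset.prod_mul_distrib, Finset.prod_div_distrib, Finset.prod_const, Finset.card_range]
  have hne : ∏ j ∈ Finset.range k, (σ ^ j) B ≠ 0 :=
    Finset.prod_ne_zero_iff.2 fun j _ => (map_ne_zero (σ ^ j)).2 hB
  rw [hprod, ← Finset.prod_range_mul_prod_Ico _ (Finset.mem_range_succ_iff.1 hk)]
  field_simp

end Riccati

/-! ### Gosper–Petkovšek forms -/

section PetkovsekForm

variable {R : Type*} [CommRing R] {σ : R →+* R}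

/-- A Gosper–Petkovšek form `σ ^ m (a / d) = (σ c / c) * (σ ^ m A / B)`, cleared of denominators:
the factor `σ c / c` gathers all the cancellations between `A` and the `σ ^ i`-shifts of `B`. -/
structure IsPetkovsekForm (σ : R →+* R) (m : ℕ) (a d A B c : R) : Prop where
  eq : (σ ^ m) a * (c * B) = (σ ^ m) d * (σ c * (σ ^ m) A)
  isCoprime : ∀ i ≤ m, IsCoprime ((σ ^ i) A) B
  isCoprime_left : IsCoprime ((σ ^ m) A) c
  isCoprime_right : IsCoprime B (σ c)

theorem IsPetkovsekForm.of_isCoprime {a d : R} (h : IsCoprime a d) :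
    IsPetkovsekForm σ 0 a d a d 1 where
  eq := by simp [mul_comm]
  isCoprime i hi := by simpa [Nat.le_zero.1 hi] using h
  isCoprime_left := isCoprime_one_right
  isCoprime_right := by simpa using isCoprime_one_right

variable {m : ℕ} {a d A B c : R}

theorem IsPetkovsekForm.isCoprime_of_dvd (h : IsPetkovsekForm σ m a d A B c) {i : ℕ} (hi : i ≤ m)
    {x y : R} (hx : x ∣ (σ ^ (i + 1)) A) (hy : y ∣ σ B) : IsCoprime x y := by
  rw [pow_succ_apply] at hx
  exact (((h.isCoprime i hi).map σ).of_isCoprime_of_dvd_left hx).of_isCoprime_of_dvd_right hy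

/-- The new factor of `c` comes from `σ ^ (m + 1) γ / γ = σ π / π` with
`π = γ * σ γ * ⋯ * σ ^ m γ`. -/
theorem IsPetkovsekForm.succ [IsDomain R] (h : IsPetkovsekForm σ m a d A B c) {A' B' γ : R}
    (hA : A = A' * γ) (hB : σ B = B' * γ) (hγ : γ ≠ 0) (hcop : IsCoprime A' B') :
    IsPetkovsekForm σ (m + 1) a d A' B' (σ c * ∏ i ∈ Finset.range (m + 1), (σ ^ i) γ) := by
  have hA' : A' ∣ A := Dvd.intro _ hA.symm
  have hγA : γ ∣ A := Dvd.intro_left _ hA.symm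
  have hB' : B' ∣ σ B := Dvd.intro _ hB.symm
  have hγB : γ ∣ σ B := Dvd.intro_left _ hB.symm
  constructor
  · have hπ : σ (∏ i ∈ Finset.range (m + 1), (σ ^ i) γ) * γ =
        (∏ i ∈ Finset.range (m + 1), (σ ^ i) γ) * (σ ^ (m + 1)) γ := by
      rw [← Finset.prod_range_succ, Finset.prod_range_succ' _ (m + 1)]
      simp only [map_prod, pow_succ_apply, pow_zero, RingHom.coe_one, id]
    have heq := congrArg σ h.eq
    simp only [map_mul, ← pow_succ_apply, hB, hA] at heq
    refine mul_right_cancel₀ hγ ?_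
    rw [map_mul]
    linear_combination (∏ i ∈ Finset.range (m + 1), (σ ^ i) γ) * heq -
      (σ ^ (m + 1)) d * σ (σ c) * (σ ^ (m + 1)) A' * hπ
  · rintro (_ | i) hi
    · exact hcop
    · exact h.isCoprime_of_dvd (Nat.succ_le_succ_iff.1 hi) (map_dvd _ hA') hB'
  · refine IsCoprime.mul_right ?_ (IsCoprime.prod_right fun i hi => ?_)
    · refine (h.isCoprime_left.map σ).of_isCoprime_of_dvd_left ?_
      rw [← pow_succ_apply]
      exact map_dvd _ hA'
    · have hi' : i ≤ m := Finset.mem_range_succ_iff.1 hi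
      have hcop_i := (h.isCoprime_of_dvd (Nat.sub_le m i) dvd_rfl hγB).map (σ ^ i)
      rw [← pow_add_apply, ← add_assoc, Nat.add_sub_cancel' hi'] at hcop_i
      exact hcop_i.of_isCoprime_of_dvd_left (map_dvd _ hA')
  · rw [map_mul, map_prod]
    refine IsCoprime.mul_right ((h.isCoprime_right.map σ).of_isCoprime_of_dvd_left hB')
      (IsCoprime.prod_right fun i hi => ?_)
    rw [← pow_succ_apply]
    exact (h.isCoprime_of_dvd (Finset.mem_range_succ_iff.1 hi) (map_dvd _ hγA) hB').symm

theorem exists_isCoprime_mul_eq [IsDomain R] [IsBezout R] {x y : R} (hx : x ≠ 0) :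
    ∃ x' y' g, g ≠ 0 ∧ IsCoprime x' y' ∧ x = x' * g ∧ y = y' * g := by
  classical
  let _ := IsBezout.toGCDDomain R
  obtain ⟨x', y', hx', hy', hunit⟩ := extract_gcd x y
  exact ⟨x', y', gcd x y, fun h0 => hx (zero_dvd_iff.1 (h0 ▸ gcd_dvd_left x y)),
    (gcd_isUnit_iff x' y').1 hunit, by rw [mul_comm, ← hx'], by rw [mul_comm, ← hy']⟩

theorem exists_isPetkovsekForm [IsDomain R] [IsBezout R] (hσ : Function.Injective σ)
    (had : IsCoprime a d) (ha : a ≠ 0) (hd : d ≠ 0) (m : ℕ) :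
    ∃ A B c, A ≠ 0 ∧ B ≠ 0 ∧ c ≠ 0 ∧ IsPetkovsekForm σ m a d A B c := by
  have hmap {p : R} (hp : p ≠ 0) : σ p ≠ 0 := (map_ne_zero_iff σ hσ).2 hp
  induction m with
  | zero => exact ⟨a, d, 1, ha, hd, one_ne_zero, .of_isCoprime had⟩
  | succ m ih =>
    obtain ⟨A, B, c, hA, hB, hc, h⟩ := ih
    obtain ⟨A', B', γ, hγ, hcop, hA', hB'⟩ := exists_isCoprime_mul_eq (y := σ B) hA
    have hpow (i : ℕ) : (σ ^ i) γ ≠ 0 := by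
      induction i with
      | zero => exact hγ
      | succ i ih => rw [pow_succ_apply]; exact hmap ih
    exact ⟨A', B', _, left_ne_zero_of_mul (hA' ▸ hA), left_ne_zero_of_mul (hB' ▸ hmap hB),
      mul_ne_zero (hmap hc) (Finset.prod_ne_zero_iff.2 fun i _ => hpow i),
      h.succ hA' hB' hγ hcop⟩

end PetkovsekForm

open Polynomial

/-! ### The Mahler operator -/

theorem expandRingHom_pow_apply {R : Type*} [CommRing R] {b : ℕ} (n : ℕ) (p : R[X]) :
    ((expand R b : R[X] →+* R[X]) ^ n) p = expand R (b ^ n) p := by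
  rw [RingHom.coe_pow, expand_pow]
  rfl

section Mahler

variable {R : Type*} [CommRing R] [IsDomain R] {b : ℕ} (hb : 0 < b)

theorem mahler_algebraMap (p : R[X]) :
    mahler R hb (algebraMap _ _ p) = algebraMap _ _ (expand R b p) := by
  have h := RatFunc.map_apply_div (expand R b) (expand_nonZeroDivisors R hb) p 1
  simp only [map_one, div_one] at h
  exact h

theorem mahler_pow_algebraMap (n : ℕ) (p : R[X]) :
    (mahler R hb ^ n) (algebraMap _ _ p) = algebraMap _ _ (expand R (b ^ n) p) := by
  induction n with
  | zero => rw [pow_zero, pow_zero, expand_one, RingHom.coe_one, id]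
  | succ n ih => rw [pow_succ_apply, ih, mahler_algebraMap, expand_expand, pow_succ']

theorem mahler_C (c : R) : mahler R hb (RatFunc.C c) = RatFunc.C c := by
  rw [← RatFunc.algebraMap_C, mahler_algebraMap, expand_C]

end Mahler

section Field

variable {L : Type*} [Field L]

theorem expand_dvd_expand_iff {n : ℕ} (hn : n ≠ 0) {p q : L[X]} :
    expand L n p ∣ expand L n q ↔ p ∣ q := by
  refine ⟨fun ⟨c, hc⟩ => ⟨contract n c, ?_⟩, map_dvd (expand L n)⟩
  rw [← contract_expand n hn (f := q), hc, mul_comm, contract_mul_expand hn, mul_comm]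

theorem natDegree_eq_zero_of_expand_dvd {b : ℕ} (hb : 2 ≤ b) {p : L[X]} (h : expand L b p ∣ p) :
    p.natDegree = 0 := by
  rcases eq_or_ne p 0 with rfl | hp
  · exact natDegree_zero
  have hdeg := natDegree_le_of_dvd h hp
  rw [natDegree_expand] at hdeg
  nlinarith

theorem exists_eq_C_of_mahler_eq_self {b : ℕ} (hb : 2 ≤ b) {hb₀ : 0 < b} {q : RatFunc L}
    (h : mahler L hb₀ q = q) : ∃ c : L, q = RatFunc.C c := by
  have hcross : expand L b q.num * q.denom = q.num * expand L b q.denom := by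
    apply RatFunc.algebraMap_injective L
    rw [← RatFunc.num_div_denom q, map_div₀, mahler_algebraMap, mahler_algebraMap, div_eq_div_iff
      (RatFunc.algebraMap_ne_zero ((expand_ne_zero hb₀).2 q.denom_ne_zero))
      (RatFunc.algebraMap_ne_zero q.denom_ne_zero)] at h
    simpa only [map_mul, RatFunc.num_div_denom] using h
  have hcop : IsCoprime (expand L b q.num) (expand L b q.denom) :=
    q.isCoprime_num_denom.map (expand L b : L[X] →+* L[X])
  obtain ⟨x, hx⟩ := natDegree_eq_zero.1 <| natDegree_eq_zero_of_expand_dvd hb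
    (hcop.dvd_of_dvd_mul_right (Dvd.intro _ hcross))
  obtain ⟨y, hy⟩ := natDegree_eq_zero.1 <| natDegree_eq_zero_of_expand_dvd hb
    (hcop.symm.dvd_of_dvd_mul_left (Dvd.intro_left _ hcross.symm))
  exact ⟨x / y, by rw [← RatFunc.num_div_denom q, ← hx, ← hy, RatFunc.algebraMap_C,
    RatFunc.algebraMap_C, map_div₀]⟩

theorem mahler_div_eq_iff {b : ℕ} (hb : 2 ≤ b) {hb₀ : 0 < b} {w w' : RatFunc L} (hw : w ≠ 0)
    (hw' : w' ≠ 0) :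
    mahler L hb₀ w / w = mahler L hb₀ w' / w' ↔ ∃ a : L, a ≠ 0 ∧ w' = RatFunc.C a * w := by
  have hMw : mahler L hb₀ w ≠ 0 := (_root_.map_ne_zero _).2 hw
  constructor
  · intro h
    obtain ⟨a, ha⟩ := exists_eq_C_of_mahler_eq_self hb (hb₀ := hb₀) (q := w' / w) (by
      rw [map_div₀, div_eq_div_iff hMw hw, mul_comm w', ← (div_eq_div_iff hw hw').1 h])
    have ha0 : RatFunc.C a ≠ 0 := ha ▸ div_ne_zero hw' hw
    exact ⟨a, (_root_.map_ne_zero _).1 ha0, (div_eq_iff hw).1 ha⟩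
  · rintro ⟨a, ha, rfl⟩
    rw [map_mul, mahler_C, mul_div_mul_left _ _ ((_root_.map_ne_zero _).2 ha)]

end Field

/-! ### Twisted operators and the Riccati equation -/

/-- The polynomial `∑ k ≤ r, p k(t) * ζ ^ k * c(t ^ (b ^ k))`: this is `twistedOperator` over any
coefficient ring, needed for solutions with formal parameters. -/
def twistedSum {R : Type*} [CommSemiring R] (b r : ℕ) (p : ℕ → R[X]) (ζ : R) (c : R[X]) : R[X] :=
  ∑ k ∈ Finset.range (r + 1), p k * C (ζ ^ k) * expand R (b ^ k) c

theorem twistedOperator_apply {L : Type*} [Field L] (b r : ℕ) (p : ℕ → L[X]) (ζ : L) (c : L[X]) :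
    twistedOperator b r p ζ c = twistedSum b r p ζ c := by
  simp only [twistedOperator, twistedSum, LinearMap.sum_apply, LinearMap.comp_apply,
    LinearMap.mulLeft_apply, AlgHom.toLinearMap_apply]

theorem map_twistedSum {R S : Type*} [CommSemiring R] [CommSemiring S] (φ : R →+* S) (b r : ℕ)
    (p : ℕ → R[X]) (ζ : R) (c : R[X]) :
    (twistedSum b r p ζ c).map φ = twistedSum b r (fun k => (p k).map φ) (φ ζ) (c.map φ) := by
  simp only [twistedSum, Polynomial.map_sum, Polynomial.map_mul, map_pow, Polynomial.map_pow,
    map_C, map_expand]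

theorem twistedSum_sum_C_mul {R ι : Type*} [CommSemiring R] (b r : ℕ) (p : ℕ → R[X]) (ζ : R)
    (s : Finset ι) (a : ι → R) (c : ι → R[X]) :
    twistedSum b r p ζ (∑ i ∈ s, C (a i) * c i) = ∑ i ∈ s, C (a i) * twistedSum b r p ζ (c i) := by
  simp only [twistedSum, map_sum, map_mul, expand_C, Finset.mul_sum]
  rw [Finset.sum_comm]
  exact Finset.sum_congr rfl fun i _ => Finset.sum_congr rfl fun k _ => mul_left_comm _ _ _

section AuxiliaryOperator

variable {K : Type*} [Field K] (E : MahlerEquation K)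
variable {R : Type*} [CommRing R] [IsDomain R]

/-- The rational function `ζ * (A(t ^ (b ^ (r - 1))) / B(t)) * (c(t ^ b) / c(t))`, whose preimages
under `M ^ (r - 1)` the algorithm looks for. -/
def MahlerEquation.petkovsekForm (A B : R[X]) (ζ : R) (c : R[X]) : RatFunc R :=
  RatFunc.C ζ *
    ((mahler R E.b_pos ^ (E.r - 1)) (algebraMap _ _ A) / algebraMap _ _ B) *
    (mahler R E.b_pos (algebraMap _ _ c) / algebraMap _ _ c)

theorem MahlerEquation.petkovsekForm_eq_div (A B : R[X]) (ζ : R) (c : R[X]) :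
    E.petkovsekForm A B ζ c =
      algebraMap _ _ (C ζ * expand R (E.b ^ (E.r - 1)) A * expand R E.b c) /
        algebraMap _ _ (B * c) := by
  rw [petkovsekForm, mahler_pow_algebraMap, mahler_algebraMap, ← RatFunc.algebraMap_C, map_mul,
    map_mul, map_mul, mul_div_mul_comm, mul_div_assoc]

variable {L : Type*} [Field L] [Algebra K L]

theorem MahlerEquation.coeff_zero_ne : E.coeff L 0 ≠ 0 :=
  (Polynomial.map_ne_zero_iff (algebraMap K L).injective).2 E.ℓ_zero_ne

theorem MahlerEquation.coeff_order_ne : E.coeff L E.r ≠ 0 :=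
  (Polynomial.map_ne_zero_iff (algebraMap K L).injective).2 E.ℓ_order_ne

theorem MahlerEquation.riccati_petkovsekForm_eq_zero_iff (φ : L →+* R) (A : L[X]) {B : L[X]}
    (hB : B ≠ 0) (ζ : L) {c : R[X]} (hc : c ≠ 0) :
    riccati (mahler R E.b_pos) E.r
        (fun k => (mahler R E.b_pos ^ (E.r - 1)) (algebraMap _ _ ((E.coeff L k).map φ)))
        (E.petkovsekForm (A.map φ) (B.map φ) (φ ζ) c) = 0 ↔
      twistedSum E.b E.r (fun k => (auxCoeff E L A B k).map φ) (φ ζ) c = 0 := by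
  have hBφ : algebraMap R[X] (RatFunc R) (B.map φ) ≠ 0 :=
    RatFunc.algebraMap_ne_zero ((Polynomial.map_ne_zero_iff φ.injective).2 hB)
  have hprod : ∏ j ∈ Finset.range E.r, (mahler R E.b_pos ^ j) (algebraMap _ _ (B.map φ)) ≠ 0 :=
    Finset.prod_ne_zero_iff.2 fun j _ => (_root_.map_ne_zero _).2 hBφ
  have hsum : algebraMap R[X] (RatFunc R)
      (twistedSum E.b E.r (fun k => (auxCoeff E L A B k).map φ) (φ ζ) c) = _ :=
    Eq.trans (by
      simp only [twistedSum, auxCoeff, Polynomial.map_mul, Polynomial.map_prod, map_expand, map_sum,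
        map_mul, map_prod, map_pow, RatFunc.algebraMap_C, mahler_pow_algebraMap])
    (riccati_petkovsekForm (σ := mahler R E.b_pos) (A := algebraMap _ _ (A.map φ))
      (c := algebraMap _ _ c) hBφ (mahler_C E.b_pos (φ ζ)) (E.r - 1) E.r
      fun k => algebraMap _ _ ((E.coeff L k).map φ)).symm
  rw [← map_eq_zero_iff (algebraMap R[X] (RatFunc R)) (RatFunc.algebraMap_injective R), hsum,
    mul_eq_zero_iff_right hprod, mul_eq_zero_iff_right (RatFunc.algebraMap_ne_zero hc)]
  rfl

theorem MahlerEquation.petkovsekForm_mem_fieldRange (φ : L →+* R) {A B : L[X]} (hB : B ≠ 0) {ζ : L}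
    {c : R[X]} (hc : c ≠ 0)
    (h : twistedSum E.b E.r (fun k => (auxCoeff E L A B k).map φ) (φ ζ) c = 0) :
    E.petkovsekForm (A.map φ) (B.map φ) (φ ζ) c ∈ (mahler R E.b_pos ^ (E.r - 1)).fieldRange :=
  mem_fieldRange_pow_of_riccati_eq_zero
    (RatFunc.algebraMap_ne_zero ((Polynomial.map_ne_zero_iff φ.injective).2 E.coeff_zero_ne))
    ((E.riccati_petkovsekForm_eq_zero_iff φ A hB ζ hc).2 h)

theorem mem_riccatiSolutions_iff {u : RatFunc L} :
    u ∈ E.riccatiSolutions L ↔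
      riccati (mahler L E.b_pos) E.r (fun k => algebraMap _ _ (E.coeff L k)) u = 0 := by
  simp only [MahlerEquation.riccatiSolutions, MahlerEquation.M, Set.mem_ofPred_eq, riccati,
    RingHom.coe_pow]

theorem mem_riccatiSolutions_iff_twistedOperator_eq_zero {u : RatFunc L} {A B c : L[X]} {ζ : L}
    (hB : B ≠ 0) (hc : c ≠ 0)
    (hu : (mahler L E.b_pos ^ (E.r - 1)) u = E.petkovsekForm A B ζ c) :
    u ∈ E.riccatiSolutions L ↔ twistedOperator E.b E.r (auxCoeff E L A B) ζ c = 0 := by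
  have h := E.riccati_petkovsekForm_eq_zero_iff (RingHom.id L) A hB ζ hc
  simp only [Polynomial.map_id, RingHom.id_apply] at h
  rw [twistedOperator_apply, ← h, mem_riccatiSolutions_iff, ← hu,
    ← map_eq_zero (mahler L E.b_pos ^ (E.r - 1)),
    riccati_map fun x => (pow_succ_apply' _ _ x).symm.trans (pow_succ_apply _ _ x)]

theorem ne_zero_of_mem_riccatiSolutions {u : RatFunc L} (hu : u ∈ E.riccatiSolutions L) :
    u ≠ 0 := by
  rintro rfl
  rw [mem_riccatiSolutions_iff, riccati_eq_add_mul, mul_zero, zero_add] at hu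
  exact RatFunc.algebraMap_ne_zero E.coeff_zero_ne hu

end AuxiliaryOperator

/-! ### Newton polygons -/

section SupportingLine

variable {R : Type*} [CommSemiring R] {b r : ℕ} {p : ℕ → R[X]}

open Classical in
/-- The coefficient of the point of abscissa `b ^ k` on the line `y = m * x + h`, and `0` if the
Newton polygon of `∑ k, p k * M ^ k` has no such point. -/
def lineCoeff (b : ℕ) (p : ℕ → R[X]) (m h : ℚ) (k : ℕ) : R :=
  ∑ j ∈ (p k).support with ((j : ℕ) : ℚ) = m * (b : ℚ) ^ k + h, (p k).coeff j

theorem lineCoeff_eq_coeff {m h : ℚ} {k j : ℕ} (hj : (j : ℚ) = m * (b : ℚ) ^ k + h) :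
    lineCoeff b p m h k = (p k).coeff j := by
  classical
  refine Finset.sum_eq_single j (fun i hi hij => ?_) fun hj' => ?_
  · exact absurd (Nat.cast_injective ((Finset.mem_filter.1 hi).2.trans hj.symm)) hij
  · exact notMem_support_iff.1 fun hmem => hj' (Finset.mem_filter.2 ⟨hmem, hj⟩)

theorem lineCoeff_ne_zero_iff {m h : ℚ} {k : ℕ} :
    lineCoeff b p m h k ≠ 0 ↔ ∃ j ∈ (p k).support, (j : ℚ) = m * (b : ℚ) ^ k + h := by
  constructor
  · intro hne
    obtain ⟨j, hj, -⟩ := Finset.exists_ne_zero_of_sum_ne_zero hne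
    exact ⟨j, Finset.mem_filter.1 hj⟩
  · rintro ⟨j, hj, hjm⟩
    rw [lineCoeff_eq_coeff hjm]
    exact mem_support_iff.1 hj

/-- The line `y = m * x + h` supports the Newton polygon of `∑ k ≤ r, p k * M ^ k` from above.
Unlike for an edge, it may touch the polygon at a single vertex. -/
structure IsSupportingLine (b r : ℕ) (p : ℕ → R[X]) (m h : ℚ) : Prop where
  below : ∀ k ≤ r, ∀ j ∈ (p k).support, (j : ℚ) ≤ m * (b : ℚ) ^ k + h
  touches : ∃ k ≤ r, ∃ j ∈ (p k).support, (j : ℚ) = m * (b : ℚ) ^ k + h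

theorem exists_isSupportingLine (b : ℕ) (hp : ∃ k ≤ r, p k ≠ 0) (m : ℚ) :
    ∃ h, IsSupportingLine b r p m h := by
  let points : Finset (Σ _ : ℕ, ℕ) := (Finset.range (r + 1)).sigma fun k => (p k).support
  have mem_points {k j : ℕ} : ⟨k, j⟩ ∈ points ↔ k ≤ r ∧ j ∈ (p k).support := by
    rw [Finset.mem_sigma, Finset.mem_range_succ_iff]
  have hne : points.Nonempty := by
    obtain ⟨k, hk, hpk⟩ := hp
    obtain ⟨j, hj⟩ := nonempty_support_iff.2 hpk
    exact ⟨⟨k, j⟩, mem_points.2 ⟨hk, hj⟩⟩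
  obtain ⟨⟨k, j⟩, hmem, hmax⟩ :=
    Finset.exists_max_image points (fun x => (x.2 : ℚ) - m * (b : ℚ) ^ x.1) hne
  refine ⟨j - m * (b : ℚ) ^ k, fun k' hk' j' hj' => ?_, k, (mem_points.1 hmem).1, j,
    (mem_points.1 hmem).2, (add_sub_cancel _ _).symm⟩
  exact sub_le_iff_le_add'.1 (hmax ⟨k', j'⟩ (mem_points.2 ⟨hk', hj'⟩))

theorem coeff_mul_expand_of_le {p c : R[X]} {d H : ℕ} (hd : 0 < d)
    (h : ∀ j ∈ p.support, j + c.natDegree * d ≤ H) :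
    (p * expand R d c).coeff H =
      if c.natDegree * d ≤ H then p.coeff (H - c.natDegree * d) * c.leadingCoeff else 0 := by
  split_ifs with hle
  · have hp : p.natDegree ≤ H - c.natDegree * d :=
      natDegree_le_iff_coeff_eq_zero.2 fun j hj => by
        by_contra hne
        have := h j (mem_support_iff.2 hne)
        omega
    rw [leadingCoeff, ← coeff_expand_mul hd c c.natDegree,
      ← coeff_mul_add_eq_of_natDegree_le hp (natDegree_expand d c).le, Nat.sub_add_cancel hle]
  · have hp : p = 0 := by
      by_contra hne
      obtain ⟨j, hj⟩ := nonempty_support_iff.2 hne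
      exact hle ((Nat.le_add_left _ _).trans (h j hj))
    rw [hp, zero_mul, coeff_zero]

theorem coeff_twistedSum_of_isSupportingLine (hb : 0 < b) {c : R[X]} {H : ℕ}
    (hline : IsSupportingLine b r p (-(c.natDegree : ℚ)) H) (ζ : R) :
    (twistedSum b r p ζ c).coeff H =
      (∑ k ∈ Finset.range (r + 1), lineCoeff b p (-(c.natDegree : ℚ)) H k * ζ ^ k) *
        c.leadingCoeff := by
  rw [twistedSum, finsetSum_coeff, Finset.sum_mul]
  refine Finset.sum_congr rfl fun k hk => ?_
  have hbelow (j : ℕ) (hj : j ∈ (p k).support) : j + c.natDegree * b ^ k ≤ H := by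
    have := hline.below k (Finset.mem_range_succ_iff.1 hk) j hj
    rw [← Nat.cast_le (α := ℚ)]
    push_cast
    linarith
  have hiff (j : ℕ) : (j : ℚ) = -(c.natDegree : ℚ) * (b : ℚ) ^ k + H ↔
      j + c.natDegree * b ^ k = H := by
    rw [← Nat.cast_inj (R := ℚ)]
    push_cast
    constructor <;> intro <;> linarith
  rw [mul_right_comm, coeff_mul_C, coeff_mul_expand_of_le (pow_pos hb k) hbelow]
  split_ifs with hle
  · rw [lineCoeff_eq_coeff ((hiff _).2 (Nat.sub_add_cancel hle)), mul_right_comm]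
  · have hzero : lineCoeff b p (-(c.natDegree : ℚ)) H k = 0 := by
      by_contra hne
      obtain ⟨j, -, hj⟩ := lineCoeff_ne_zero_iff.1 hne
      exact hle (Nat.le.intro ((Nat.add_comm _ _).trans ((hiff j).1 hj)))
    rw [hzero, zero_mul, zero_mul]

end SupportingLine

section Edges

variable {L : Type*} [Field L] {b r : ℕ} {p : ℕ → L[X]} {k₁ k₂ : ℕ} {m h : ℚ}

theorem edgeCharPoly_eq_sum_lineCoeff (b : ℕ) (p : ℕ → L[X]) (k₁ k₂ : ℕ) (m h : ℚ) :
    edgeCharPoly b p k₁ k₂ m h =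
      ∑ k ∈ Finset.Icc k₁ k₂, C (lineCoeff b p m h k) * X ^ (k - k₁) := by
  simp only [edgeCharPoly, lineCoeff, map_sum, Finset.sum_mul]

theorem IsUpperEdge.pow_mul_eval_edgeCharPoly (he : IsUpperEdge b r p k₁ k₂ m h) (ζ : L) :
    ζ ^ k₁ * (edgeCharPoly b p k₁ k₂ m h).eval ζ =
      ∑ k ∈ Finset.range (r + 1), lineCoeff b p m h k * ζ ^ k := by
  have hsub : Finset.Icc k₁ k₂ ⊆ Finset.range (r + 1) := fun k hk =>
    Finset.mem_range_succ_iff.2 ((Finset.mem_Icc.1 hk).2.trans he.le)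
  have houtside (k : ℕ) (hk : k ∈ Finset.range (r + 1)) (hk' : k ∉ Finset.Icc k₁ k₂) :
      lineCoeff b p m h k * ζ ^ k = 0 := by
    by_contra hne
    obtain ⟨j, hj, hjm⟩ := lineCoeff_ne_zero_iff.1 (left_ne_zero_of_mul hne)
    exact hk' (Finset.mem_Icc.2 (he.between k (Finset.mem_range_succ_iff.1 hk) j hj hjm))
  rw [edgeCharPoly_eq_sum_lineCoeff, eval_finsetSum, Finset.mul_sum,
    ← Finset.sum_subset hsub houtside]
  refine Finset.sum_congr rfl fun k hk => ?_
  rw [eval_mul, eval_C, eval_pow, eval_X, mul_left_comm, ← pow_add,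
    Nat.add_sub_cancel' (Finset.mem_Icc.1 hk).1]

theorem IsUpperEdge.eval_zero_edgeCharPoly_ne (he : IsUpperEdge b r p k₁ k₂ m h) :
    (edgeCharPoly b p k₁ k₂ m h).eval 0 ≠ 0 := by
  rw [edgeCharPoly_eq_sum_lineCoeff, eval_finsetSum,
    Finset.sum_eq_single_of_mem k₁ (Finset.left_mem_Icc.2 he.lt.le) fun k hk hne => ?_]
  · rw [Nat.sub_self, pow_zero, mul_one, eval_C]
    exact lineCoeff_ne_zero_iff.2 he.left
  · rw [eval_mul, eval_pow, eval_X, zero_pow (Nat.sub_ne_zero_of_lt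
      (lt_of_le_of_ne (Finset.mem_Icc.1 hk).1 hne.symm)), mul_zero]

theorem IsSupportingLine.hasAdmissibleEdge (hline : IsSupportingLine b r p m h) {ζ : L}
    (hζ : ζ ≠ 0) (hsum : ∑ k ∈ Finset.range (r + 1), lineCoeff b p m h k * ζ ^ k = 0) :
    HasAdmissibleEdge b r p ζ m := by
  classical
  let T := (Finset.range (r + 1)).filter fun k => lineCoeff b p m h k ≠ 0
  have mem_T {k : ℕ} : k ∈ T ↔ k ≤ r ∧ lineCoeff b p m h k ≠ 0 := by
    rw [Finset.mem_filter, Finset.mem_range_succ_iff]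
  have hT : T.Nonempty := by
    obtain ⟨k, hk, hj⟩ := hline.touches
    exact ⟨k, mem_T.2 ⟨hk, lineCoeff_ne_zero_iff.2 hj⟩⟩
  have hmin := mem_T.1 (T.min'_mem hT)
  have hmax := mem_T.1 (T.max'_mem hT)
  have hlt : T.min' hT < T.max' hT := by
    refine T.min'_lt_max'_of_card (Nat.lt_of_le_of_ne hT.card_pos fun hcard => ?_)
    obtain ⟨k, hk⟩ := Finset.card_eq_one.1 hcard.symm
    have hkT := mem_T.1 (hk ▸ Finset.mem_singleton_self k)
    refine mul_ne_zero hkT.2 (pow_ne_zero k hζ) ?_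
    rw [← hsum]
    refine (Finset.sum_eq_single_of_mem (f := fun k => lineCoeff b p m h k * ζ ^ k) k
      (Finset.mem_range_succ_iff.2 hkT.1) ?_).symm
    intro k' hk' hne
    by_contra hne'
    have hk'T : k' ∈ T :=
      mem_T.2 ⟨Finset.mem_range_succ_iff.1 hk', left_ne_zero_of_mul hne'⟩
    exact hne (Finset.mem_singleton.1 (hk ▸ hk'T))
  have he : IsUpperEdge b r p (T.min' hT) (T.max' hT) m h :=
    { lt := hlt
      le := hmax.1
      below := hline.below
      left := lineCoeff_ne_zero_iff.1 hmin.2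
      right := lineCoeff_ne_zero_iff.1 hmax.2
      between := fun k hk j hj hjm =>
        have hkT := mem_T.2 ⟨hk, lineCoeff_ne_zero_iff.2 ⟨j, hj, hjm⟩⟩
        ⟨T.min'_le k hkT, T.le_max' k hkT⟩ }
  refine ⟨_, _, h, he, (mul_eq_zero.1 ?_).resolve_left (pow_ne_zero (T.min' hT) hζ)⟩
  rw [he.pow_mul_eval_edgeCharPoly, hsum]

theorem hasAdmissibleEdge_of_twistedOperator_eq_zero (hb : 0 < b) (hp : ∃ k ≤ r, p k ≠ 0) {ζ : L}
    (hζ : ζ ≠ 0) {c : L[X]} (hc : c ≠ 0) (h : twistedOperator b r p ζ c = 0) :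
    HasAdmissibleEdge b r p ζ (-(c.natDegree : ℚ)) := by
  obtain ⟨y, hline⟩ := exists_isSupportingLine b hp (-(c.natDegree : ℚ))
  obtain ⟨H, rfl⟩ : ∃ H : ℕ, y = H := by
    obtain ⟨k, -, j, -, hj⟩ := hline.touches
    refine ⟨j + c.natDegree * b ^ k, ?_⟩
    push_cast
    linarith
  refine hline.hasAdmissibleEdge hζ ((mul_eq_zero.1 ?_).resolve_right (leadingCoeff_ne_zero.2 hc))
  rw [← coeff_twistedSum_of_isSupportingLine hb hline, ← twistedOperator_apply, h, coeff_zero]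

theorem finite_setOf_isUpperEdge (hb : 2 ≤ b) :
    {e : (ℕ × ℕ) × ℚ × ℚ | IsUpperEdge b r p e.1.1 e.1.2 e.2.1 e.2.2}.Finite := by
  let points : Finset (Σ _ : ℕ, ℕ) := (Finset.range (r + 1)).sigma fun k => (p k).support
  let lineThrough (x y : Σ _ : ℕ, ℕ) : (ℕ × ℕ) × ℚ × ℚ :=
    let m : ℚ := ((y.2 : ℚ) - x.2) / ((b : ℚ) ^ y.1 - (b : ℚ) ^ x.1)
    ((x.1, y.1), m, x.2 - m * (b : ℚ) ^ x.1)
  refine (Set.Finite.image2 lineThrough points.finite_toSet points.finite_toSet).subset ?_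
  rintro ⟨⟨k₁, k₂⟩, m, h⟩ ⟨lt, le, -, ⟨j₁, hj₁, h₁⟩, ⟨j₂, hj₂, h₂⟩, -⟩
  dsimp only at lt le hj₁ h₁ hj₂ h₂
  have hlt : (b : ℚ) ^ k₁ < (b : ℚ) ^ k₂ := pow_lt_pow_right₀ (by exact_mod_cast hb) lt
  have hm : ((j₂ : ℚ) - j₁) / ((b : ℚ) ^ k₂ - (b : ℚ) ^ k₁) = m := by
    rw [div_eq_iff (sub_ne_zero.2 hlt.ne'), h₁, h₂]
    ring
  have hh : (j₁ : ℚ) - m * (b : ℚ) ^ k₁ = h := by rw [h₁]; ring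
  refine ⟨⟨k₁, j₁⟩, ?_, ⟨k₂, j₂⟩, ?_, ?_⟩
  · exact Finset.mem_sigma.2 ⟨Finset.mem_range_succ_iff.2 (lt.le.trans le), hj₁⟩
  · exact Finset.mem_sigma.2 ⟨Finset.mem_range_succ_iff.2 le, hj₂⟩
  · simp only [lineThrough, hm, hh]

theorem zero_notMem_upperRoots : (0 : L) ∉ upperRoots b r p := by
  rintro ⟨m, k₁, k₂, h, he, hroot⟩
  exact he.eval_zero_edgeCharPoly_ne hroot

theorem finite_upperRoots (hb : 2 ≤ b) : (upperRoots b r p).Finite := by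
  refine ((finite_setOf_isUpperEdge (r := r) (p := p) hb).biUnion fun e he =>
    finite_setOfPred_isRoot (p := edgeCharPoly b p e.1.1 e.1.2 e.2.1 e.2.2) fun h0 =>
      IsUpperEdge.eval_zero_edgeCharPoly_ne he (by rw [h0, eval_zero])).subset ?_
  rintro ζ ⟨m, k₁, k₂, h, he, hroot⟩
  exact Set.mem_biUnion (x := ((k₁, k₂), m, h)) he hroot

theorem finite_setOf_hasAdmissibleEdge (hb : 2 ≤ b) (ζ : L) :
    {m : ℚ | HasAdmissibleEdge b r p ζ m}.Finite := by
  refine ((finite_setOf_isUpperEdge (r := r) (p := p) hb).image fun e => e.2.1).subset ?_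
  rintro m ⟨k₁, k₂, h, he, -⟩
  exact ⟨((k₁, k₂), m, h), he, rfl⟩

end Edges

/-! ### The iterations of the main loop -/

section Iteration

variable {K : Type*} [Field K] {E : MahlerEquation K}
variable {L : Type*} [Field L]

theorem MahlerEquation.petkovsekForm_C_mul (E : MahlerEquation K) (A B : L[X]) (ζ : L) (c : L[X])
    (x y : L) : E.petkovsekForm (C x * A) (C y * B) ζ c = E.petkovsekForm A B (ζ * x / y) c := by
  simp only [petkovsekForm, mahler_pow_algebraMap]
  simp only [map_mul, map_div₀, expand_C, RatFunc.algebraMap_C, mul_div_mul_comm]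
  ring

theorem IsPetkovsekForm.mahler_pow_eq_petkovsekForm {u : RatFunc L} {A B c : L[X]}
    (h : IsPetkovsekForm (expand L E.b : L[X] →+* L[X]) (E.r - 1) u.num u.denom A B c)
    (hB : B ≠ 0) (hc : c ≠ 0) :
    (mahler L E.b_pos ^ (E.r - 1)) u = E.petkovsekForm A B 1 c := by
  have heq := h.eq
  simp only [expandRingHom_pow_apply, RingHom.coe_coe] at heq
  conv_lhs => rw [← RatFunc.num_div_denom u]
  rw [map_div₀, mahler_pow_algebraMap, mahler_pow_algebraMap, E.petkovsekForm_eq_div,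
    div_eq_div_iff (RatFunc.algebraMap_ne_zero
      ((expand_ne_zero (pow_pos E.b_pos _)).2 u.denom_ne_zero))
      (RatFunc.algebraMap_ne_zero (mul_ne_zero hB hc)), ← map_mul, ← map_mul, map_one, one_mul]
  congr 1
  linear_combination heq

theorem IsPetkovsekForm.isCoprime_expand {b m : ℕ} {a d A B A' B' c : L[X]}
    (h : IsPetkovsekForm (expand L b : L[X] →+* L[X]) m a d A B c) (hA : A' ∣ A) (hB : B' ∣ B) :
    (∀ i ≤ m, IsCoprime (expand L (b ^ i) A') B') ∧ IsCoprime (expand L (b ^ m) A') c ∧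
      IsCoprime B' (expand L b c) := by
  obtain ⟨-, hcop, hleft, hright⟩ := h
  simp only [expandRingHom_pow_apply, RingHom.coe_coe] at hcop hleft hright
  have hA' (i : ℕ) : expand L (b ^ i) A' ∣ expand L (b ^ i) A :=
    _root_.map_dvd (expand L (b ^ i)) hA
  exact ⟨fun i hi => ((hcop i hi).of_isCoprime_of_dvd_left (hA' i)).of_isCoprime_of_dvd_right hB,
    hleft.of_isCoprime_of_dvd_left (hA' m), hright.of_isCoprime_of_dvd_left hB⟩

theorem exists_mahler_pow_eq_petkovsekForm (E : MahlerEquation K) {u : RatFunc L} (hu : u ≠ 0) :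
    ∃ (A B c : L[X]) (ζ : L), A.Monic ∧ B.Monic ∧ c ≠ 0 ∧ ζ ≠ 0 ∧
      (mahler L E.b_pos ^ (E.r - 1)) u = E.petkovsekForm A B ζ c ∧
      (∀ i ≤ E.r - 1, IsCoprime (expand L (E.b ^ i) A) B) ∧
      IsCoprime (expand L (E.b ^ (E.r - 1)) A) c ∧ IsCoprime B (expand L E.b c) := by
  obtain ⟨A, B, c, hA, hB, hc, h⟩ :=
    exists_isPetkovsekForm (σ := (expand L E.b : L[X] →+* L[X])) (expand_injective E.b_pos)
      u.isCoprime_num_denom (RatFunc.num_ne_zero hu) u.denom_ne_zero (E.r - 1)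
  have hscale {p : L[X]} (hp : p ≠ 0) : p = C p.leadingCoeff * (p * C p.leadingCoeff⁻¹) := by
    rw [mul_left_comm, ← C_mul, mul_inv_cancel₀ (leadingCoeff_ne_zero.2 hp), C_1, mul_one]
  refine ⟨A * C A.leadingCoeff⁻¹, B * C B.leadingCoeff⁻¹, c, 1 * A.leadingCoeff / B.leadingCoeff,
    monic_mul_leadingCoeff_inv hA, monic_mul_leadingCoeff_inv hB, hc,
    div_ne_zero (mul_ne_zero one_ne_zero (leadingCoeff_ne_zero.2 hA)) (leadingCoeff_ne_zero.2 hB),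
    ?_, h.isCoprime_expand (Dvd.intro_left _ (hscale hA).symm)
      (Dvd.intro_left _ (hscale hB).symm)⟩
  rw [h.mahler_pow_eq_petkovsekForm hB hc]
  exact (congrArg₂ (E.petkovsekForm · · 1 c) (hscale hA) (hscale hB)).trans
    (E.petkovsekForm_C_mul _ _ _ _ _ _)

variable [Algebra K L]

theorem auxCoeff_zero_ne {A B : L[X]} (hB : B ≠ 0) : auxCoeff E L A B 0 ≠ 0 := by
  rw [auxCoeff, Finset.range_zero, Finset.prod_empty, mul_one]
  exact mul_ne_zero ((expand_ne_zero (pow_pos E.b_pos _)).2 E.coeff_zero_ne)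
    (Finset.prod_ne_zero_iff.2 fun j _ => (expand_ne_zero (pow_pos E.b_pos _)).2 hB)

/-- All the terms of `twistedOperator` but the one of index `0` are multiples of `M ^ (r - 1) A`. -/
theorem dvd_coeff_zero_of_twistedOperator_eq_zero {A B c : L[X]} {ζ : L}
    (hAB : ∀ i < E.r, IsCoprime (expand L (E.b ^ i) A) B)
    (hAc : IsCoprime (expand L (E.b ^ (E.r - 1)) A) c)
    (h : twistedOperator E.b E.r (auxCoeff E L A B) ζ c = 0) : A ∣ E.coeff L 0 := by
  have hdvd : expand L (E.b ^ (E.r - 1)) A ∣ ∑ k ∈ Finset.range E.r,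
      auxCoeff E L A B (k + 1) * C (ζ ^ (k + 1)) * expand L (E.b ^ (k + 1)) c := by
    refine Finset.dvd_sum fun k _ => ?_
    have hfactor : expand L (E.b ^ (E.r - 1)) A ∣
        ∏ j ∈ Finset.range (k + 1), expand L (E.b ^ (E.r - 1 + j)) A := by
      simpa only [add_zero] using Finset.dvd_prod_of_mem
        (fun j => expand L (E.b ^ (E.r - 1 + j)) A) (Finset.mem_range.2 k.succ_pos)
    exact (((hfactor.mul_left _).mul_right _).mul_right _).mul_right _
  have hcop (j : ℕ) (hj : j ∈ Finset.Ico 0 E.r) :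
      IsCoprime (expand L (E.b ^ (E.r - 1)) A) (expand L (E.b ^ j) B) := by
    have hj' := (Finset.mem_Ico.1 hj).2
    have hexp : E.r - 1 = j + (E.r - 1 - j) := by omega
    rw [hexp, pow_add, ← expand_expand]
    exact (hAB (E.r - 1 - j) (by omega)).map (expand L (E.b ^ j) : L[X] →+* L[X])
  rw [twistedOperator_apply, twistedSum, Finset.sum_range_succ'] at h
  have hfirst := (dvd_add_right hdvd).1 (h.symm ▸ dvd_zero _)
  simp only [auxCoeff, Finset.range_zero, Finset.prod_empty, mul_one, pow_zero, map_one,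
    expand_one] at hfirst
  exact (expand_dvd_expand_iff (pow_pos E.b_pos (E.r - 1)).ne').1
    ((IsCoprime.prod_right hcop).dvd_of_dvd_mul_right (hAc.dvd_of_dvd_mul_right hfirst))

/-- All the terms of `twistedOperator` but the one of index `r` are multiples of `M ^ (r - 1) B`. -/
theorem dvd_coeff_order_of_twistedOperator_eq_zero {A B c : L[X]} {ζ : L} (hζ : ζ ≠ 0)
    (hAB : ∀ i < E.r, IsCoprime (expand L (E.b ^ i) A) B) (hBc : IsCoprime B (expand L E.b c))
    (h : twistedOperator E.b E.r (auxCoeff E L A B) ζ c = 0) : B ∣ E.coeff L E.r := by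
  have hr := E.two_le_r
  have hdvd : expand L (E.b ^ (E.r - 1)) B ∣ ∑ k ∈ Finset.range E.r,
      auxCoeff E L A B k * C (ζ ^ k) * expand L (E.b ^ k) c := by
    refine Finset.dvd_sum fun k hk => ?_
    have hk' := Finset.mem_range.1 hk
    have hfactor : expand L (E.b ^ (E.r - 1)) B ∣ ∏ j ∈ Finset.Ico k E.r, expand L (E.b ^ j) B :=
      Finset.dvd_prod_of_mem (fun j => expand L (E.b ^ j) B)
        (Finset.mem_Ico.2 ⟨by omega, by omega⟩)
    exact ((hfactor.mul_left _).mul_right _).mul_right _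
  have hexpand {p q : L[X]} (hpq : IsCoprime p q) :
      IsCoprime (expand L (E.b ^ (E.r - 1)) p) (expand L (E.b ^ (E.r - 1)) q) :=
    hpq.map (expand L (E.b ^ (E.r - 1)) : L[X] →+* L[X])
  have hcopA (j : ℕ) (hj : j ∈ Finset.range E.r) :
      IsCoprime (expand L (E.b ^ (E.r - 1)) B) (expand L (E.b ^ (E.r - 1 + j)) A) := by
    rw [pow_add, ← expand_expand]
    exact hexpand (hAB j (Finset.mem_range.1 hj)).symm
  have hcopc : IsCoprime (expand L (E.b ^ (E.r - 1)) B) (expand L (E.b ^ E.r) c) := by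
    have hexp : E.r = E.r - 1 + 1 := by omega
    conv_rhs => rw [hexp, pow_succ, ← expand_expand]
    exact hexpand hBc
  rw [twistedOperator_apply, twistedSum, Finset.sum_range_succ] at h
  have hlast := (dvd_add_right hdvd).1 (h.symm ▸ dvd_zero _)
  simp only [auxCoeff, Finset.Ico_self, Finset.prod_empty, mul_one] at hlast
  have hunit : IsUnit (C (ζ ^ E.r)) := isUnit_C.2 (pow_ne_zero _ hζ).isUnit
  exact (expand_dvd_expand_iff (pow_pos E.b_pos (E.r - 1)).ne').1
    ((IsCoprime.prod_right hcopA).dvd_of_dvd_mul_right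
      (hunit.dvd_mul_right.1 (hcopc.dvd_of_dvd_mul_right hlast)))

namespace Iteration

theorem ext_of_eq {i j : Iteration E L} (hA : i.A = j.A) (hB : i.B = j.B) (hζ : i.ζ = j.ζ) :
    i = j := by
  obtain ⟨A, B, ζ, Δ, _, _, _, _, _, _, h⟩ := i
  obtain ⟨A', B', ζ', Δ', _, _, _, _, _, _, h'⟩ := j
  dsimp only at hA hB hζ
  subst hA hB hζ
  obtain rfl : Δ = Δ' := by exact_mod_cast h.unique h'
  rfl

variable (E L) in
theorem finite : Finite (Iteration E L) := by
  have hdivisors (f : L[X]) (hf : f ≠ 0) : {g : L[X] | g.Monic ∧ g ∣ f}.Finite :=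
    @Set.toFinite _ _ (@Finite.of_fintype _ (fintypeSubtypeMonicDvd f hf))
  let pairs : Set (L[X] × L[X]) :=
    {A | A.Monic ∧ A ∣ E.coeff L 0} ×ˢ {B | B.Monic ∧ B ∣ E.coeff L E.r}
  have hpairs : pairs.Finite := (hdivisors _ E.coeff_zero_ne).prod (hdivisors _ E.coeff_order_ne)
  have htriples : (⋃ x ∈ pairs, (fun ζ : L => (x, ζ)) ''
      upperRoots E.b E.r (auxCoeff E L x.1 x.2)).Finite :=
    hpairs.biUnion fun x _ => (finite_upperRoots E.two_le_b).image _
  refine Set.finite_univ_iff.1 (Set.Finite.of_finite_image (f := fun i : Iteration E L =>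
    ((i.A, i.B), i.ζ)) (htriples.subset ?_) ?_)
  · rintro _ ⟨i, -, rfl⟩
    exact Set.mem_biUnion (x := (i.A, i.B)) ⟨⟨i.A_monic, i.A_dvd⟩, i.B_monic, i.B_dvd⟩
      ⟨i.ζ, i.ζ_mem, rfl⟩
  · rintro i - j - hij
    simp only [Prod.mk.injEq] at hij
    exact ext_of_eq hij.1.1 hij.1.2 hij.2

theorem ζ_ne_zero (i : Iteration E L) : i.ζ ≠ 0 := fun h =>
  zero_notMem_upperRoots (h ▸ i.ζ_mem)

theorem mem_solSpace {i : Iteration E L} {c : L[X]} :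
    c ∈ i.solSpace ↔ c.degree ≤ (i.Δ : WithBot ℕ) ∧
      twistedOperator E.b E.r (auxCoeff E L i.A i.B) i.ζ c = 0 := by
  rw [solSpace, Submodule.mem_inf, mem_degreeLE, LinearMap.mem_ker]

instance finite_solSpace (i : Iteration E L) : Module.Finite L i.solSpace := by
  have hle : i.solSpace ≤ degreeLT L (i.Δ + 1) := fun c hc =>
    mem_degreeLT.2 ((mem_solSpace.1 hc).1.trans_lt (by exact_mod_cast Nat.lt_succ_self i.Δ))
  have : Module.Finite L (degreeLT L (i.Δ + 1)) :=
    Module.Finite.equiv (degreeLTEquiv L (i.Δ + 1)).symm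
  exact Module.Finite.of_injective (Submodule.inclusion hle) (Submodule.inclusion_injective hle)

end Iteration

theorem exists_iteration {u : RatFunc L} (hu : u ∈ E.riccatiSolutions L) :
    ∃ i : Iteration E L, ∃ c ∈ i.solSpace, c ≠ 0 ∧
      (mahler L E.b_pos ^ (E.r - 1)) u = E.petkovsekForm i.A i.B i.ζ c := by
  obtain ⟨A, B, c, ζ, hA, hB, hc, hζ, hform, hcop, hAc, hBc⟩ :=
    exists_mahler_pow_eq_petkovsekForm E (ne_zero_of_mem_riccatiSolutions E hu)
  have hAB : ∀ i < E.r, IsCoprime (expand L (E.b ^ i) A) B := fun i hi =>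
    hcop i (Nat.le_sub_one_of_lt hi)
  have hker := (mem_riccatiSolutions_iff_twistedOperator_eq_zero E hB.ne_zero hc hform).1 hu
  let slopes : Set ℤ := {d | HasAdmissibleEdge E.b E.r (auxCoeff E L A B) ζ (-(d : ℚ))}
  have hslopes : slopes.Finite :=
    (finite_setOf_hasAdmissibleEdge E.two_le_b ζ).preimage (f := fun d : ℤ => -(d : ℚ))
      fun x _ y _ h => by simpa using h
  have hdeg : (c.natDegree : ℤ) ∈ slopes := by
    have := hasAdmissibleEdge_of_twistedOperator_eq_zero E.b_pos
      ⟨0, Nat.zero_le _, auxCoeff_zero_ne hB.ne_zero⟩ hζ hc hker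
    exact_mod_cast this
  obtain ⟨d, hd, hmax⟩ := Set.exists_max_image slopes id hslopes ⟨_, hdeg⟩
  have hcd : (c.natDegree : ℤ) ≤ d := hmax _ hdeg
  obtain ⟨Δ, rfl⟩ := Int.eq_ofNat_of_zero_le ((Int.natCast_nonneg _).trans hcd)
  let i : Iteration E L :=
    { A, B, ζ, Δ
      A_monic := hA
      A_dvd := dvd_coeff_zero_of_twistedOperator_eq_zero hAB hAc hker
      B_monic := hB
      B_dvd := dvd_coeff_order_of_twistedOperator_eq_zero hζ hAB hBc hker
      coprime := hAB
      ζ_mem := ⟨_, hdeg⟩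
      Δ_greatest := ⟨hd, hmax⟩ }
  refine ⟨i, c, Iteration.mem_solSpace.2 ⟨?_, hker⟩, hc, hform⟩
  exact natDegree_le_iff_degree_le.1 (by exact_mod_cast hcd)

end Iteration

/-! ### Specialization of the parameters -/

section Specialization

variable {R : Type*} [CommRing R] {L : Type*} [Field L] (ev : R →+* L)

theorem exists_map_contract_X_pow_mul_ne_zero {n : ℕ} (hn : n ≠ 0) {Q : R[X]} (hQ : Q.map ev ≠ 0) :
    ∃ e, (contract n (X ^ e * Q)).map ev ≠ 0 := by
  obtain ⟨k, hk⟩ := not_forall.1 (Polynomial.ext_iff.not.1 hQ)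
  have hle : k ≤ k * n := Nat.le_mul_of_pos_right k hn.bot_lt
  refine ⟨k * n - k, fun h => hk ?_⟩
  have hcoeff := congrArg (coeff · k) h
  simp only [map_contract hn, coeff_contract hn, Polynomial.map_mul, Polynomial.map_pow, map_X,
    coeff_zero] at hcoeff
  rwa [coeff_X_pow_mul', if_pos (Nat.sub_le _ _), Nat.sub_sub_self hle] at hcoeff

variable {ev} in
theorem ne_zero_of_map_ne_zero {Q : R[X]} (hQ : Q.map ev ≠ 0) : Q ≠ 0 := fun h =>
  hQ (h ▸ Polynomial.map_zero ev)

variable [IsDomain R] {b : ℕ} (hb : 0 < b) (m : ℕ)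

theorem mahler_pow_div_eq_div_iff {P Q P' Q' : R[X]} (hQ : Q ≠ 0) (hQ' : Q' ≠ 0) :
    (mahler R hb ^ m) (algebraMap _ _ P / algebraMap _ _ Q) =
        algebraMap _ _ P' / algebraMap _ _ Q' ↔
      expand R (b ^ m) P * Q' = P' * expand R (b ^ m) Q := by
  rw [map_div₀, mahler_pow_algebraMap, mahler_pow_algebraMap, div_eq_div_iff
    (RatFunc.algebraMap_ne_zero ((expand_ne_zero (pow_pos hb m)).2 hQ))
    (RatFunc.algebraMap_ne_zero hQ'), ← map_mul, ← map_mul, (RatFunc.algebraMap_injective R).eq_iff]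

theorem mahler_pow_map_div_map {P Q P' Q' : R[X]} (hQ : Q.map ev ≠ 0) (hQ' : Q'.map ev ≠ 0)
    (h : (mahler R hb ^ m) (algebraMap _ _ P / algebraMap _ _ Q) =
      algebraMap _ _ P' / algebraMap _ _ Q') :
    (mahler L hb ^ m) (algebraMap _ _ (P.map ev) / algebraMap _ _ (Q.map ev)) =
      algebraMap _ _ (P'.map ev) / algebraMap _ _ (Q'.map ev) := by
  rw [mahler_pow_div_eq_div_iff hb m (ne_zero_of_map_ne_zero hQ)
    (ne_zero_of_map_ne_zero hQ')] at h
  rw [mahler_pow_div_eq_div_iff hb m hQ hQ']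
  simpa only [Polynomial.map_mul, map_expand] using congrArg (Polynomial.map ev) h

theorem exists_eq_div_of_mahler_pow_eq_div {u : RatFunc R} {P Q : R[X]} (hQ : Q.map ev ≠ 0)
    (hu : (mahler R hb ^ m) u = algebraMap _ _ P / algebraMap _ _ Q) :
    ∃ P' Q' : R[X], Q'.map ev ≠ 0 ∧ u = algebraMap _ _ P' / algebraMap _ _ Q' := by
  have hn : b ^ m ≠ 0 := (pow_pos hb m).ne'
  obtain ⟨p, q, hq, rfl⟩ := IsFractionRing.div_surjective R[X] u
  have hq₀ := nonZeroDivisors.ne_zero hq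
  rw [mahler_pow_div_eq_div_iff hb m hq₀ (ne_zero_of_map_ne_zero hQ)] at hu
  obtain ⟨e, he⟩ := exists_map_contract_X_pow_mul_ne_zero ev hn hQ
  refine ⟨contract (b ^ m) (X ^ e * P), contract (b ^ m) (X ^ e * Q), he, ?_⟩
  rw [div_eq_div_iff (RatFunc.algebraMap_ne_zero hq₀)
    (RatFunc.algebraMap_ne_zero (ne_zero_of_map_ne_zero he)), ← map_mul, ← map_mul, mul_comm p,
    ← contract_mul_expand hn, ← contract_mul_expand hn]
  congr 2
  linear_combination X ^ e * hu

end Specialization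

theorem Param.isValueAt_iff_of_mahler_pow_eq_div {L : Type*} [Field L] {b : ℕ} (hb : 0 < b) (m : ℕ)
    {p : Param L} {γ : Fin p.1 → L} {P Q : (MvPolynomial (Fin p.1) L)[X]}
    (hQ : Q.map (MvPolynomial.eval γ) ≠ 0)
    (hp : (mahler _ hb ^ m) p.2 = algebraMap _ _ P / algebraMap _ _ Q) {v : RatFunc L} :
    p.IsValueAt γ v ↔
      (mahler L hb ^ m) v = algebraMap _ _ (P.map (MvPolynomial.eval γ)) /
        algebraMap _ _ (Q.map (MvPolynomial.eval γ)) := by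
  constructor
  · rintro ⟨P', Q', hQ', hPQ, rfl⟩
    exact mahler_pow_map_div_map _ hb m hQ' hQ (hPQ ▸ hp)
  · intro hv
    obtain ⟨P', Q', hQ', hPQ⟩ := exists_eq_div_of_mahler_pow_eq_div _ hb m hQ hp
    refine ⟨P', Q', hQ', hPQ, (mahler L hb ^ m).injective (hv.trans ?_)⟩
    exact (mahler_pow_map_div_map _ hb m hQ' hQ (hPQ ▸ hp)).symm

theorem Param.isBijectiveParametrization_of_forall {L : Type*} [Field L] {p : Param L}
    (hp : 0 < p.1) (hval : ∀ γ : Fin p.1 → L, γ ≠ 0 → ∃ v, p.IsValueAt γ v)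
    (heq : ∀ {γ γ' v v'}, γ ≠ 0 → γ' ≠ 0 → p.IsValueAt γ v → p.IsValueAt γ' v' →
      (v = v' ↔ ∃ a : L, a • γ' = γ)) : p.IsBijectiveParametrization := by
  choose f hf using hval
  let φ : Projectivization L (Fin p.1 → L) → RatFunc L :=
    Projectivization.lift (fun γ => f γ.1 γ.2) fun γ γ' a h =>
      (heq γ.2 γ'.2 (hf _ _) (hf _ _)).2 ⟨a, h.symm⟩
  refine ⟨hp, φ, hf, ?_, ?_, ?_⟩
  · rintro ⟨γ⟩ -
    exact ⟨γ.1, γ.2, hf _ _⟩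
  · intro x _ y _ hxy
    induction x with | h γ hγ =>
    induction y with | h γ' hγ' =>
    exact (Projectivization.mk_eq_mk_iff' L γ γ' hγ hγ').2
      ((heq hγ hγ' (hf _ _) (hf _ _)).1 hxy)
  · rintro v ⟨γ, hγ, hv⟩
    exact ⟨Projectivization.mk L γ hγ, Set.mem_univ _,
      (heq hγ hγ (hf _ _) hv).2 ⟨1, one_smul _ _⟩⟩

/-! ### The parametrizations gathered by the main loop -/

theorem map_eval_genericSolution {L : Type*} [Field L] {s : ℕ} (Cs : Fin s → L[X])
    (γ : Fin s → L) :
    (genericSolution Cs).map (MvPolynomial.eval γ) = ∑ i, γ i • Cs i := by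
  have heval : (MvPolynomial.eval γ).comp MvPolynomial.C = RingHom.id L :=
    RingHom.ext (MvPolynomial.eval_C (f := γ))
  simp only [genericSolution, Polynomial.map_sum, Polynomial.map_mul, map_C, MvPolynomial.eval_X,
    Polynomial.map_map, heval, Polynomial.map_id, smul_eq_C_mul]

theorem twistedSum_genericSolution_eq_zero {L : Type*} [Field L] {b r s : ℕ} {p : ℕ → L[X]} {ζ : L}
    {Cs : Fin s → L[X]} (h : ∀ i, twistedOperator b r p ζ (Cs i) = 0) :
    twistedSum b r (fun k => (p k).map MvPolynomial.C) (MvPolynomial.C ζ)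
      (genericSolution Cs) = 0 := by
  rw [genericSolution, twistedSum_sum_C_mul]
  refine Finset.sum_eq_zero fun i _ => ?_
  rw [← map_twistedSum, ← twistedOperator_apply, h, Polynomial.map_zero, mul_zero]

section Candidates

variable {K : Type*} [Field K] {E : MahlerEquation K}
variable {L : Type*} [Field L] [Algebra K L] {β : BasisChoice E L} {i : Iteration E L}

theorem map_eval_genericSolution_basis (β : BasisChoice E L) (i : Iteration E L)
    (γ : Fin i.dim → L) :
    (genericSolution fun j => (β i j : L[X])).map (MvPolynomial.eval γ) =
      (β i).equivFun.symm γ := by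
  rw [map_eval_genericSolution, Module.Basis.equivFun_symm_apply, Submodule.coe_sum]
  rfl

theorem equivFun_symm_ne_zero (β : BasisChoice E L) {γ : Fin i.dim → L} (hγ : γ ≠ 0) :
    ((β i).equivFun.symm γ : L[X]) ≠ 0 := fun h =>
  hγ ((β i).equivFun.symm.map_eq_zero_iff.1 (Subtype.ext h))

theorem isIdentified_iff {u : RatFunc (MvPolynomial (Fin i.dim) L)} :
    IsIdentified β i u ↔
      (mahler _ E.b_pos ^ (E.r - 1)) u =
        E.petkovsekForm (i.A.map MvPolynomial.C) (i.B.map MvPolynomial.C) (MvPolynomial.C i.ζ)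
          (genericSolution fun j => (β i j : L[X])) := by
  rw [IsIdentified, ← RingHom.coe_pow, Iteration.formalFunction, MahlerEquation.petkovsekForm,
    mahler_algebraMap, mahler_pow_algebraMap, map_expand, mul_right_comm]

theorem existsUnique_isIdentified (β : BasisChoice E L) (i : Iteration E L) (hi : 0 < i.dim) :
    ∃! u, IsIdentified β i u := by
  have : Nonempty (Fin i.dim) := ⟨⟨0, hi⟩⟩
  have hne : genericSolution (fun j => (β i j : L[X])) ≠ 0 := by
    refine ne_zero_of_map_ne_zero (ev := MvPolynomial.eval 1) ?_
    rw [map_eval_genericSolution_basis]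
    exact equivFun_symm_ne_zero β one_ne_zero
  obtain ⟨u, hu⟩ := E.petkovsekForm_mem_fieldRange MvPolynomial.C i.B_monic.ne_zero hne
    (twistedSum_genericSolution_eq_zero fun j => (Iteration.mem_solSpace.1 (β i j).2).2)
  exact ⟨u, isIdentified_iff.2 hu, fun v hv =>
    (mahler _ E.b_pos ^ (E.r - 1)).injective ((isIdentified_iff.1 hv).trans hu.symm)⟩

theorem isValueAt_iff {u : RatFunc (MvPolynomial (Fin i.dim) L)} (hu : IsIdentified β i u)
    {γ : Fin i.dim → L} (hγ : γ ≠ 0) {v : RatFunc L} :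
    Param.IsValueAt ⟨i.dim, u⟩ γ v ↔
      (mahler L E.b_pos ^ (E.r - 1)) v =
        E.petkovsekForm i.A i.B i.ζ ((β i).equivFun.symm γ : L[X]) := by
  have heval : (MvPolynomial.eval γ).comp MvPolynomial.C = RingHom.id L :=
    RingHom.ext (MvPolynomial.eval_C (f := γ))
  have hform := isIdentified_iff.1 hu
  rw [E.petkovsekForm_eq_div] at hform
  rw [Param.isValueAt_iff_of_mahler_pow_eq_div (p := ⟨i.dim, u⟩) E.b_pos _ ?_ hform,
    E.petkovsekForm_eq_div]
  · simp only [Polynomial.map_mul, map_C, map_expand, Polynomial.map_map, heval, Polynomial.map_id,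
      MvPolynomial.eval_C, map_eval_genericSolution_basis]
  · simp only [Polynomial.map_mul, Polynomial.map_map, heval, Polynomial.map_id,
      map_eval_genericSolution_basis]
    exact mul_ne_zero i.B_monic.ne_zero (equivFun_symm_ne_zero β hγ)

theorem Iteration.exists_mahler_pow_eq_petkovsekForm {c : L[X]} (hc : c ≠ 0)
    (h : c ∈ i.solSpace) :
    ∃ v, (mahler L E.b_pos ^ (E.r - 1)) v = E.petkovsekForm i.A i.B i.ζ c := by
  have hker := (Iteration.mem_solSpace.1 h).2
  rw [twistedOperator_apply] at hker
  have hmem := E.petkovsekForm_mem_fieldRange (A := i.A) (ζ := i.ζ) (RingHom.id L)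
    i.B_monic.ne_zero hc (by simpa only [Polynomial.map_id, RingHom.id_apply] using hker)
  simpa only [Polynomial.map_id, RingHom.id_apply, RingHom.mem_fieldRange] using hmem

theorem Iteration.petkovsekForm_ne_zero (i : Iteration E L) {c : L[X]} (hc : c ≠ 0) :
    E.petkovsekForm i.A i.B i.ζ c ≠ 0 := by
  have hc' := RatFunc.algebraMap_ne_zero hc
  exact mul_ne_zero (mul_ne_zero ((_root_.map_ne_zero _).2 i.ζ_ne_zero)
      (div_ne_zero ((_root_.map_ne_zero _).2 (RatFunc.algebraMap_ne_zero i.A_monic.ne_zero))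
        (RatFunc.algebraMap_ne_zero i.B_monic.ne_zero)))
    (div_ne_zero ((_root_.map_ne_zero _).2 hc') hc')

theorem Iteration.petkovsekForm_div (i : Iteration E L) {c c' : L[X]} (hc : c ≠ 0) :
    E.petkovsekForm i.A i.B i.ζ c' / E.petkovsekForm i.A i.B i.ζ c =
      mahler L E.b_pos (algebraMap _ _ c' / algebraMap _ _ c) /
        (algebraMap _ _ c' / algebraMap _ _ c) := by
  have hform := i.petkovsekForm_ne_zero hc
  rw [MahlerEquation.petkovsekForm] at hform
  rw [MahlerEquation.petkovsekForm, MahlerEquation.petkovsekForm,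
    mul_div_mul_left _ _ (left_ne_zero_of_mul hform), map_div₀, div_div_div_comm]

theorem Iteration.petkovsekForm_eq_iff (i : Iteration E L) {c c' : L[X]} (hc : c ≠ 0)
    (hc' : c' ≠ 0) :
    E.petkovsekForm i.A i.B i.ζ c' = E.petkovsekForm i.A i.B i.ζ c ↔ ∃ a : L, a • c = c' := by
  have hcR := RatFunc.algebraMap_ne_zero hc
  have hcR' := RatFunc.algebraMap_ne_zero hc'
  have hone : mahler L E.b_pos 1 / 1 = 1 := by rw [map_one, div_one]
  have hquot := mahler_div_eq_iff E.two_le_b (hb₀ := E.b_pos) (one_ne_zero (α := RatFunc L))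
    (div_ne_zero hcR' hcR)
  rw [← div_eq_one_iff_eq (i.petkovsekForm_ne_zero hc), i.petkovsekForm_div hc, eq_comm,
    ← hone, hquot]
  simp only [mul_one, div_eq_iff hcR, ← RatFunc.algebraMap_C, ← map_mul,
    (RatFunc.algebraMap_injective L).eq_iff, ← smul_eq_C_mul]
  refine ⟨fun ⟨a, _, h⟩ => ⟨a, h.symm⟩, fun ⟨a, h⟩ => ⟨a, ?_, h.symm⟩⟩
  rintro rfl
  exact hc' (by rw [← h, zero_smul])

theorem isBijectiveParametrization {u : RatFunc (MvPolynomial (Fin i.dim) L)} (hi : 0 < i.dim)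
    (hu : IsIdentified β i u) : Param.IsBijectiveParametrization ⟨i.dim, u⟩ := by
  refine Param.isBijectiveParametrization_of_forall hi (fun γ hγ => ?_) fun hγ hγ' hv hv' => ?_
  · simp only [isValueAt_iff hu hγ]
    exact Iteration.exists_mahler_pow_eq_petkovsekForm (equivFun_symm_ne_zero β hγ)
      ((β i).equivFun.symm γ).2
  · rw [← (mahler L E.b_pos ^ (E.r - 1)).injective.eq_iff, (isValueAt_iff hu hγ).1 hv,
      (isValueAt_iff hu hγ').1 hv', i.petkovsekForm_eq_iff (equivFun_symm_ne_zero β hγ')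
        (equivFun_symm_ne_zero β hγ)]
    simp only [← Submodule.coe_smul, ← map_smul, SetLike.coe_eq_coe,
      (β i).equivFun.symm.injective.eq_iff]

/-- The set of rational functions that the nonzero solutions `C` of an iteration give rise to. -/
def Iteration.values (i : Iteration E L) : Set (RatFunc L) :=
  {v | ∃ c ∈ i.solSpace, c ≠ 0 ∧
    (mahler L E.b_pos ^ (E.r - 1)) v = E.petkovsekForm i.A i.B i.ζ c}

theorem image_eq_values {u : RatFunc (MvPolynomial (Fin i.dim) L)} (hu : IsIdentified β i u) :
    Param.image ⟨i.dim, u⟩ = i.values := by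
  ext v
  constructor
  · rintro ⟨γ, hγ, hv⟩
    exact ⟨_, ((β i).equivFun.symm γ).2, equivFun_symm_ne_zero β hγ, (isValueAt_iff hu hγ).1 hv⟩
  · rintro ⟨c, hc, hc₀, hv⟩
    have hγ : (β i).equivFun ⟨c, hc⟩ ≠ 0 := fun h =>
      hc₀ (congrArg Subtype.val ((β i).equivFun.map_eq_zero_iff.1 h))
    exact ⟨_, hγ, (isValueAt_iff hu hγ).2 (by rw [hv, LinearEquiv.symm_apply_apply])⟩

end Candidates

/-! ### Classes of solutions of the Riccati equation -/

section Classes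

variable {K : Type*} [Field K] (E : MahlerEquation K) {L : Type*} [Field L]

variable (L) in
/-- The iterate `M ^ n` of the Mahler operator, as an `L`-linear endomorphism of `L(x)`. -/
def MahlerEquation.mahlerPow (n : ℕ) : RatFunc L →ₗ[L] RatFunc L where
  toFun := ⇑(mahler L E.b_pos ^ n : RatFunc L →+* RatFunc L)
  map_add' := map_add _
  map_smul' a q := by
    rw [RatFunc.smul_eq_C_mul, map_mul, pow_apply_of_map_eq_self (mahler_C E.b_pos a),
      RatFunc.smul_eq_C_mul, RingHom.id_apply]

variable [Algebra K L]

/-- The solutions of the Riccati equation that differ from `u₀` by a factor `M q / q`. -/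
def riccatiClass (u₀ : RatFunc L) : Set (RatFunc L) :=
  {u | u ∈ E.riccatiSolutions L ∧ ∃ q : RatFunc L, q ≠ 0 ∧ u = u₀ * (mahler L E.b_pos q / q)}

theorem mem_riccatiClass_self {u : RatFunc L} (hu : u ∈ E.riccatiSolutions L) :
    u ∈ riccatiClass E u :=
  ⟨hu, 1, one_ne_zero, by rw [map_one, div_one, mul_one]⟩

theorem riccatiClass_eq_of_mem {u v : RatFunc L} (h : v ∈ riccatiClass E u) :
    riccatiClass E v = riccatiClass E u := by
  obtain ⟨-, q, hq, rfl⟩ := h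
  have hMq : mahler L E.b_pos q ≠ 0 := (_root_.map_ne_zero _).2 hq
  ext w
  constructor
  · rintro ⟨hw, q', hq', rfl⟩
    exact ⟨hw, q * q', mul_ne_zero hq hq', by rw [map_mul, mul_div_mul_comm, mul_assoc]⟩
  · rintro ⟨hw, q', hq', rfl⟩
    refine ⟨hw, q' / q, div_ne_zero hq' hq, ?_⟩
    rw [map_div₀]
    field_simp

variable (L) in
/-- The `q ∈ L(x)` such that, for a solution `y` of `M y = u₀ * y`, the product `q * y` satisfies
the linear Mahler equation. -/
def gaugeSpace (u₀ : RatFunc L) : Submodule L (RatFunc L) :=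
  LinearMap.ker (∑ k ∈ Finset.range (E.r + 1),
    LinearMap.mulLeft L (algebraMap _ _ (E.coeff L k) *
      ∏ j ∈ Finset.range k, (mahler L E.b_pos ^ j) u₀) ∘ₗ E.mahlerPow L k)

theorem mem_gaugeSpace_iff {u₀ q : RatFunc L} (hq : q ≠ 0) :
    q ∈ gaugeSpace E L u₀ ↔ u₀ * (mahler L E.b_pos q / q) ∈ E.riccatiSolutions L := by
  rw [mem_riccatiSolutions_iff, ← mul_eq_zero_iff_right hq, riccati_mul_map_div, gaugeSpace,
    LinearMap.mem_ker, LinearMap.sum_apply]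
  rfl

variable {E}

theorem Iteration.values_subset_riccatiSolutions (i : Iteration E L) :
    i.values ⊆ E.riccatiSolutions L := by
  rintro v ⟨c, hc, hc₀, hv⟩
  exact (mem_riccatiSolutions_iff_twistedOperator_eq_zero E i.B_monic.ne_zero hc₀ hv).2
    (Iteration.mem_solSpace.1 hc).2

theorem Iteration.values_subset_riccatiClass {i : Iteration E L} {u : RatFunc L}
    (hu : u ∈ i.values) : i.values ⊆ riccatiClass E u := by
  intro v hv
  have hsol := i.values_subset_riccatiSolutions hv
  have hu₀ := ne_zero_of_mem_riccatiSolutions E (i.values_subset_riccatiSolutions hu)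
  obtain ⟨c, -, hc, hu⟩ := hu
  obtain ⟨d, -, hd, hv⟩ := hv
  obtain ⟨q, hq, -, hquot⟩ := exists_eq_map_div_of_pow_eq (σ := mahler L E.b_pos) (x := v / u)
    (div_ne_zero (RatFunc.algebraMap_ne_zero hd) (RatFunc.algebraMap_ne_zero hc))
    (by rw [map_div₀, hu, hv, i.petkovsekForm_div hc])
  exact ⟨hsol, q, hq, by rw [← hquot, mul_div_cancel₀ _ hu₀]⟩

theorem Iteration.mahler_pow_gauge_eq_petkovsekForm_iff {i : Iteration E L} {u₀ q q₁ : RatFunc L}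
    {c c₁ : L[X]} (hu₀ : u₀ ≠ 0) (hq : q ≠ 0) (hq₁ : q₁ ≠ 0) (hc : c ≠ 0) (hc₁ : c₁ ≠ 0)
    (h₁ : (mahler L E.b_pos ^ (E.r - 1)) (u₀ * (mahler L E.b_pos q₁ / q₁)) =
      E.petkovsekForm i.A i.B i.ζ c₁) :
    (mahler L E.b_pos ^ (E.r - 1)) (u₀ * (mahler L E.b_pos q / q)) =
        E.petkovsekForm i.A i.B i.ζ c ↔
      ∃ a : L, a ≠ 0 ∧ (mahler L E.b_pos ^ (E.r - 1)) (q / q₁) =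
        RatFunc.C a * (algebraMap _ _ c / algebraMap _ _ c₁) := by
  have hquot : u₀ * (mahler L E.b_pos q / q) / (u₀ * (mahler L E.b_pos q₁ / q₁)) =
      mahler L E.b_pos (q / q₁) / (q / q₁) := by
    rw [mul_div_mul_left _ _ hu₀, map_div₀, div_div_div_comm]
  rw [← div_left_inj' (i.petkovsekForm_ne_zero hc₁), i.petkovsekForm_div hc₁, ← h₁, ← map_div₀,
    hquot, map_div₀, ← pow_succ_apply', pow_succ_apply, eq_comm, mahler_div_eq_iff E.two_le_b]
  · exact div_ne_zero (RatFunc.algebraMap_ne_zero hc) (RatFunc.algebraMap_ne_zero hc₁)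
  · exact (_root_.map_ne_zero _).2 (div_ne_zero hq hq₁)

theorem Iteration.exists_submodule_gauge_mem_values (i : Iteration E L) {u₀ : RatFunc L}
    (hu₀ : u₀ ≠ 0) :
    ∃ W : Submodule L (RatFunc L), ∀ q ≠ 0,
      (q ∈ W ↔ u₀ * (mahler L E.b_pos q / q) ∈ i.values) := by
  by_cases hex : ∃ q ≠ 0, u₀ * (mahler L E.b_pos q / q) ∈ i.values
  swap
  · exact ⟨⊥, fun q hq => ⟨fun h => absurd h hq, fun h => absurd ⟨q, hq, h⟩ hex⟩⟩
  obtain ⟨q₁, hq₁, c₁, -, hc₁, h₁⟩ := hex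
  have hMq₁ : (mahler L E.b_pos ^ (E.r - 1)) q₁ ≠ 0 := (_root_.map_ne_zero _).2 hq₁
  let scale : L[X] →ₗ[L] RatFunc L :=
    LinearMap.mulLeft L ((mahler L E.b_pos ^ (E.r - 1)) q₁ / algebraMap _ _ c₁) ∘ₗ
      (IsScalarTower.toAlgHom L L[X] (RatFunc L)).toLinearMap
  have hscale (c : L[X]) (q : RatFunc L) : scale c = E.mahlerPow L (E.r - 1) q ↔
      (mahler L E.b_pos ^ (E.r - 1)) (q / q₁) = algebraMap _ _ c / algebraMap _ _ c₁ := by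
    rw [map_div₀, div_eq_iff hMq₁, div_mul_comm, eq_comm]
    rfl
  refine ⟨(i.solSpace.map scale).comap (E.mahlerPow L (E.r - 1)), fun q hq => ?_⟩
  have hMq : (mahler L E.b_pos ^ (E.r - 1)) (q / q₁) ≠ 0 :=
    (_root_.map_ne_zero _).2 (div_ne_zero hq hq₁)
  simp only [Submodule.mem_comap, Submodule.mem_map, hscale]
  constructor
  · rintro ⟨c, hc, hqc⟩
    have hc₀ : c ≠ 0 := by
      rintro rfl
      exact hMq (by rw [hqc, map_zero, zero_div])
    exact ⟨c, hc, hc₀, (mahler_pow_gauge_eq_petkovsekForm_iff hu₀ hq hq₁ hc₀ hc₁ h₁).2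
      ⟨1, one_ne_zero, by rw [hqc, map_one, one_mul]⟩⟩
  · rintro ⟨c, hc, hc₀, hqc⟩
    obtain ⟨a, -, ha⟩ := (mahler_pow_gauge_eq_petkovsekForm_iff hu₀ hq hq₁ hc₀ hc₁ h₁).1 hqc
    exact ⟨a • c, i.solSpace.smul_mem a hc, by
      rw [ha, smul_eq_C_mul, map_mul, RatFunc.algebraMap_C, mul_div_assoc]⟩

theorem exists_values_eq_riccatiClass [Infinite L] {u₀ : RatFunc L}
    (hu₀ : u₀ ∈ E.riccatiSolutions L) : ∃ i : Iteration E L, i.values = riccatiClass E u₀ := by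
  have := Iteration.finite E L
  choose W hW using fun i : Iteration E L =>
    i.exists_submodule_gauge_mem_values (ne_zero_of_mem_riccatiSolutions E hu₀)
  have hcover (q : RatFunc L) (hq : q ≠ 0) (hgauge : q ∈ gaugeSpace E L u₀) : ∃ i, q ∈ W i := by
    obtain ⟨i, hi⟩ := exists_iteration ((mem_gaugeSpace_iff E hq).1 hgauge)
    exact ⟨i, (hW i q hq).2 hi⟩
  have hone : (1 : RatFunc L) ∈ gaugeSpace E L u₀ := by
    rwa [mem_gaugeSpace_iff E (one_ne_zero (α := RatFunc L)), map_one, div_one, mul_one]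
  obtain ⟨i₁, -⟩ := hcover 1 one_ne_zero hone
  obtain ⟨i, hi⟩ := Subspace.exists_eq_top_of_iUnion_eq_univ
    (p := fun i => (W i).comap (gaugeSpace E L u₀).subtype) <| by
      refine Set.eq_univ_of_forall fun q => Set.mem_iUnion.2 ?_
      rcases eq_or_ne q 0 with rfl | hq
      · exact ⟨i₁, zero_mem _⟩
      · exact hcover q (Subtype.coe_ne_coe.2 hq) q.2
  have hle : gaugeSpace E L u₀ ≤ W i := Submodule.comap_subtype_eq_top.1 hi
  have hsub : riccatiClass E u₀ ⊆ i.values := by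
    rintro u ⟨hu, q, hq, rfl⟩
    exact (hW i q hq).1 (hle ((mem_gaugeSpace_iff E hq).2 hu))
  exact ⟨i, (Iteration.values_subset_riccatiClass
    (hsub (mem_riccatiClass_self E hu₀))).antisymm hsub⟩

end Classes

/-! ### First-order Mahler equations over Puiseux series -/

section PowerSeries

variable {R : Type*} [CommRing R]

/-- The coefficients of the power series `g` with constant coefficient `1` that satisfies
`g(x) * w(x) = g(x ^ b)`, when `w` has constant coefficient `1`. -/
def expandSolution {b : ℕ} (hb : 1 < b) (w : PowerSeries R) : ℕ → R
  | 0 => 1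
  | n + 1 => (if b ∣ n + 1 then expandSolution hb w ((n + 1) / b) else 0) -
      ∑ j : Fin (n + 1), expandSolution hb w j * PowerSeries.coeff (n + 1 - j) w
termination_by n => n
decreasing_by
  · exact Nat.div_lt_self n.succ_pos hb
  · exact j.2

theorem mk_expandSolution_mul {b : ℕ} (hb : 1 < b) (hb₀ : b ≠ 0) {w : PowerSeries R}
    (hw : PowerSeries.constantCoeff w = 1) :
    PowerSeries.mk (expandSolution hb w) * w =
      PowerSeries.expand b hb₀ (PowerSeries.mk (expandSolution hb w)) := by
  ext n
  rw [PowerSeries.coeff_mul, Finset.Nat.sum_antidiagonal_eq_sum_range_succ_mk,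
    Finset.sum_range_succ, PowerSeries.coeff_expand]
  simp only [PowerSeries.coeff_mk, Nat.sub_self, PowerSeries.coeff_zero_eq_constantCoeff_apply, hw,
    mul_one]
  cases n with
  | zero => rw [Finset.sum_range_zero, zero_add, if_pos (dvd_zero b), Nat.zero_div]
  | succ n =>
    rw [expandSolution, ← Fin.sum_univ_eq_sum_range
      (fun j => expandSolution hb w j * PowerSeries.coeff (n + 1 - j) w), add_sub_cancel]

theorem mk_expandSolution_ne_zero [Nontrivial R] {b : ℕ} (hb : 1 < b) (w : PowerSeries R) :
    PowerSeries.mk (expandSolution hb w) ≠ 0 := fun h =>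
  one_ne_zero (α := R) (by
    simpa only [PowerSeries.coeff_mk, expandSolution, map_zero] using
      congrArg (PowerSeries.coeff 0) h)

end PowerSeries

section Puiseux

variable {L : Type*} [Field L]

theorem ramify_single {q : ℕ} (hq : 0 < q) (n : ℤ) (a : L) :
    ramify L hq (HahnSeries.single n a) = HahnSeries.single ((n : ℚ) / q) a :=
  HahnSeries.embDomain_single

theorem ramify_ofPowerSeries (f : PowerSeries L) :
    ramify L Nat.one_pos (HahnSeries.ofPowerSeries ℤ L f) = HahnSeries.ofPowerSeries ℚ L f := by
  rw [HahnSeries.ofPowerSeries_apply, HahnSeries.ofPowerSeries_apply]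
  refine embDomain_embDomain (fun n => ?_) _
  change ((n : ℤ) : ℚ) / (1 : ℕ) = (n : ℚ)
  rw [Nat.cast_one, div_one, Int.cast_natCast]

theorem mahlerHahn_single {b : ℕ} (hb : 0 < b) (x : ℚ) (a : L) :
    mahlerHahn L hb (HahnSeries.single x a) = HahnSeries.single (b * x) a :=
  HahnSeries.embDomain_single

theorem mahlerHahn_ofPowerSeries {b : ℕ} (hb : 0 < b) (f : PowerSeries L) :
    mahlerHahn L hb (HahnSeries.ofPowerSeries ℚ L f) =
      HahnSeries.ofPowerSeries ℚ L (PowerSeries.expand b hb.ne' f) := by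
  let e : ℕ ↪o ℕ := OrderEmbedding.ofMapLEIff (fun n => b * n) fun m n =>
    mul_le_mul_iff_right₀ hb
  let e' : ℕ ↪o ℚ := OrderEmbedding.ofMapLEIff (fun n => (b : ℚ) * n) fun m n => by
    rw [mul_le_mul_iff_right₀ (Nat.cast_pos.2 hb), Nat.cast_le]
  have hexpand : HahnSeries.toPowerSeries.symm (PowerSeries.expand b hb.ne' f) =
      HahnSeries.embDomain e (HahnSeries.toPowerSeries.symm f) := by
    ext n
    rw [HahnSeries.coeff_toPowerSeries_symm, PowerSeries.coeff_expand]
    split_ifs with hn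
    · obtain ⟨k, rfl⟩ := hn
      rw [Nat.mul_div_cancel_left _ hb, show b * k = e k from rfl, HahnSeries.embDomain_coeff,
        HahnSeries.coeff_toPowerSeries_symm]
    · rw [HahnSeries.embDomain_of_notMem_range]
      rintro ⟨k, rfl⟩
      exact hn ⟨k, rfl⟩
  rw [HahnSeries.ofPowerSeries_apply, HahnSeries.ofPowerSeries_apply, hexpand]
  exact (embDomain_embDomain (h := e') (fun n => rfl) _).trans
    (embDomain_embDomain (h := e') (fun n => Nat.cast_mul b n) _).symm

theorem coe_ratToPuiseux_algebraMap (p : L[X]) :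
    (ratToPuiseux L (algebraMap _ _ p) : HahnSeries ℚ L) = HahnSeries.ofPowerSeries ℚ L p := by
  change ramify L Nat.one_pos (ratToLaurent L (algebraMap _ _ p)) = _
  rw [ratToLaurent, IsFractionRing.lift_algebraMap, Polynomial.algebraMap_hahnSeries_apply,
    ramify_ofPowerSeries]

theorem coe_constPuiseux (a : L) : (constPuiseux L a : HahnSeries ℚ L) = HahnSeries.C a := by
  rw [constPuiseux, RingHom.comp_apply, ← RatFunc.algebraMap_C, coe_ratToPuiseux_algebraMap,
    Polynomial.coe_C, HahnSeries.ofPowerSeries_C]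

theorem mahlerPuiseux_ratToPuiseux {b : ℕ} (hb : 0 < b) (u : RatFunc L) :
    mahlerPuiseux L hb (ratToPuiseux L u) = ratToPuiseux L (mahler L hb u) := by
  have hpoly (p : L[X]) : mahlerPuiseux L hb (ratToPuiseux L (algebraMap _ _ p)) =
      ratToPuiseux L (mahler L hb (algebraMap _ _ p)) := by
    apply Subtype.ext
    change mahlerHahn L hb (ratToPuiseux L (algebraMap _ _ p) : HahnSeries ℚ L) = _
    rw [mahler_algebraMap, coe_ratToPuiseux_algebraMap, coe_ratToPuiseux_algebraMap,
      mahlerHahn_ofPowerSeries]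
    congr 1
    ext n
    rw [PowerSeries.coeff_expand, Polynomial.coeff_coe, Polynomial.coeff_coe, coeff_expand hb]
  rw [← RatFunc.num_div_denom u]
  simp only [map_div₀, hpoly]

theorem exists_eq_single_mul_C_mul_ofPowerSeries {U : LaurentSeries L} (hU : U ≠ 0) :
    ∃ (n : ℤ) (a : L) (w : PowerSeries L), a ≠ 0 ∧ PowerSeries.constantCoeff w = 1 ∧
      U = HahnSeries.single n 1 * (HahnSeries.C a * HahnSeries.ofPowerSeries ℤ L w) := by
  have ha : PowerSeries.constantCoeff U.powerSeriesPart ≠ 0 := by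
    rw [← PowerSeries.coeff_zero_eq_constantCoeff_apply, LaurentSeries.powerSeriesPart_coeff,
      Nat.cast_zero, add_zero]
    exact HahnSeries.coeff_order_eq_zero.not.2 hU
  refine ⟨U.order, _, PowerSeries.C (PowerSeries.constantCoeff U.powerSeriesPart)⁻¹ *
    U.powerSeriesPart, ha, ?_, ?_⟩
  · rw [map_mul, PowerSeries.constantCoeff_C, inv_mul_cancel₀ ha]
  · rw [← HahnSeries.ofPowerSeries_C, ← map_mul, ← mul_assoc, ← map_mul, mul_inv_cancel₀ ha,
      map_one PowerSeries.C, one_mul, LaurentSeries.single_order_mul_powerSeriesPart]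

theorem exists_mem_puiseux_mahlerHahn_eq_mul {b : ℕ} (hb : 1 < b) (hb₀ : 0 < b) (n : ℤ)
    {w : PowerSeries L} (hw : PowerSeries.constantCoeff w = 1) :
    ∃ f ∈ puiseux L, f ≠ 0 ∧ mahlerHahn L hb₀ f =
      HahnSeries.single (n : ℚ) 1 * HahnSeries.ofPowerSeries ℚ L w * f := by
  let g : PowerSeries L := PowerSeries.mk (expandSolution hb w)
  let v : ℚ := n / (b - 1 : ℕ)
  have hv : b * v = n + v := by
    have hb' : (b : ℚ) - 1 ≠ 0 := sub_ne_zero.2 (Nat.cast_ne_one.2 hb.ne')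
    simp only [v, Nat.cast_sub hb.le, Nat.cast_one]
    field_simp
    ring
  refine ⟨HahnSeries.single v 1 * HahnSeries.ofPowerSeries ℚ L g, ?_, ?_, ?_⟩
  · exact mul_mem ⟨b - 1, Nat.sub_pos_of_lt hb, HahnSeries.single n 1, ramify_single _ _ _⟩
      ⟨1, Nat.one_pos, HahnSeries.ofPowerSeries ℤ L g, ramify_ofPowerSeries g⟩
  · exact mul_ne_zero (HahnSeries.single_ne_zero one_ne_zero)
      ((map_ne_zero_iff _ HahnSeries.ofPowerSeries_injective).2 (mk_expandSolution_ne_zero hb w))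
  · rw [map_mul, mahlerHahn_single, mahlerHahn_ofPowerSeries, ← mk_expandSolution_mul hb _ hw,
      hv, map_mul, mul_mul_mul_comm, HahnSeries.single_mul_single, mul_one,
      mul_comm (HahnSeries.ofPowerSeries ℚ L w)]

theorem exists_constPuiseux_mul_mahlerPuiseux_eq_mul {b : ℕ} (hb : 1 < b) (hb₀ : 0 < b)
    {u : RatFunc L} (hu : u ≠ 0) :
    ∃ (a : Lˣ) (f : Puiseux L), f ≠ 0 ∧
      constPuiseux L a * mahlerPuiseux L hb₀ f = ratToPuiseux L u * f := by
  obtain ⟨n, a, w, ha, hw, hU⟩ := exists_eq_single_mul_C_mul_ofPowerSeries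
    ((_root_.map_ne_zero (ratToLaurent L)).2 hu)
  obtain ⟨f, hfmem, hf, hmahler⟩ := exists_mem_puiseux_mahlerHahn_eq_mul hb hb₀ n hw
  have hcoe : (ratToPuiseux L u : HahnSeries ℚ L) =
      HahnSeries.single (n : ℚ) 1 * (HahnSeries.C a * HahnSeries.ofPowerSeries ℚ L w) := by
    change ramify L Nat.one_pos (ratToLaurent L u) = _
    rw [hU, ← HahnSeries.ofPowerSeries_C, ← map_mul, map_mul, ramify_single, Nat.cast_one, div_one,
      ramify_ofPowerSeries, map_mul, HahnSeries.ofPowerSeries_C]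
  refine ⟨Units.mk0 a ha, ⟨f, hfmem⟩, fun h => hf (congrArg Subtype.val h), Subtype.ext ?_⟩
  change (constPuiseux L a : HahnSeries ℚ L) * mahlerHahn L hb₀ f =
    (ratToPuiseux L u : HahnSeries ℚ L) * f
  rw [coe_constPuiseux, hcoe, hmahler]
  ring

end Puiseux

/-! ### Hypergeometric solutions and blocks -/

section Blocks

variable {L : Type*} [Field L]

theorem mahlerGenSeries_single {b : ℕ} (hb : 0 < b) (a : Lˣ) (f : Puiseux L) :
    mahlerGenSeries L hb (MonoidAlgebra.single a f) =
      MonoidAlgebra.single a (constPuiseux L a * mahlerPuiseux L hb f) := by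
  refine (MonoidAlgebra.liftNCRingHom_single _ _ _ a f).trans ?_
  change MonoidAlgebra.single 1 (mahlerPuiseux L hb f) *
    MonoidAlgebra.single a (constPuiseux L a) = _
  rw [MonoidAlgebra.single_mul_single, one_mul, mul_comm]

theorem mahlerGenSeries_ratToGenSeries {b : ℕ} (hb : 0 < b) (u : RatFunc L) :
    mahlerGenSeries L hb (ratToGenSeries L u) = ratToGenSeries L (mahler L hb u) := by
  change mahlerGenSeries L hb (MonoidAlgebra.single 1 (ratToPuiseux L u)) =
    MonoidAlgebra.single 1 (ratToPuiseux L (mahler L hb u))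
  rw [mahlerGenSeries_single, Units.val_one, map_one, one_mul, mahlerPuiseux_ratToPuiseux]

theorem ratToGenSeries_mul_eq_zero {u : RatFunc L} {y : GenSeries L} (hy : y ≠ 0) :
    ratToGenSeries L u * y = 0 ↔ u = 0 := by
  refine ⟨fun h => ?_, fun h => by rw [h, map_zero, zero_mul]⟩
  by_contra hu
  exact hy ((((isUnit_iff_ne_zero.2 hu).map (ratToGenSeries L)).mul_right_eq_zero).1 h)

variable {K : Type*} [Field K] {E : MahlerEquation K}

theorem HasQuotient.iterate {u : RatFunc L} {y : GenSeries L} (h : HasQuotient E u y) (k : ℕ) :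
    (mahlerGenSeries L E.b_pos)^[k] y =
      ratToGenSeries L (∏ j ∈ Finset.range k, (mahler L E.b_pos ^ j) u) * y := by
  induction k with
  | zero => rw [Function.iterate_zero_apply, Finset.prod_range_zero, map_one, one_mul]
  | succ k ih =>
    rw [Function.iterate_succ_apply', ih, map_mul, mahlerGenSeries_ratToGenSeries, h,
      Finset.prod_range_succ', map_prod, ← mul_assoc, ← map_mul]
    simp only [pow_succ_apply, pow_zero, RingHom.coe_one, id]

theorem HasQuotient.unique {u u' : RatFunc L} {y : GenSeries L} (hy : y ≠ 0)
    (h : HasQuotient E u y) (h' : HasQuotient E u' y) : u = u' := by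
  rw [← sub_eq_zero, ← ratToGenSeries_mul_eq_zero hy, map_sub, sub_mul, ← h, ← h', sub_self]

theorem HasQuotient.ratToGenSeries_mul {u q : RatFunc L} {y : GenSeries L} (hq : q ≠ 0)
    (h : HasQuotient E u y) :
    HasQuotient E (u * (mahler L E.b_pos q / q)) (ratToGenSeries L q * y) := by
  rw [HasQuotient, map_mul, mahlerGenSeries_ratToGenSeries, h, ← mul_assoc, ← mul_assoc,
    ← map_mul, ← map_mul, mul_assoc u, div_mul_cancel₀ _ hq, mul_comm u]

variable (E) in
theorem exists_hasQuotient {u : RatFunc L} (hu : u ≠ 0) :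
    ∃ y : GenSeries L, y ≠ 0 ∧ HasQuotient E u y := by
  obtain ⟨a, f, hf, h⟩ := exists_constPuiseux_mul_mahlerPuiseux_eq_mul E.two_le_b E.b_pos hu
  refine ⟨MonoidAlgebra.single a f, MonoidAlgebra.single_ne_zero.2 hf, ?_⟩
  rw [HasQuotient, mahlerGenSeries_single, h]
  change _ = MonoidAlgebra.single 1 (ratToPuiseux L u) * MonoidAlgebra.single a f
  rw [MonoidAlgebra.single_mul_single, one_mul]

variable [Algebra K L]

theorem HasQuotient.isLinearSolution_iff {u : RatFunc L} {y : GenSeries L} (hy : y ≠ 0)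
    (h : HasQuotient E u y) : IsLinearSolution E y ↔ u ∈ E.riccatiSolutions L := by
  rw [mem_riccatiSolutions_iff, riccati, ← ratToGenSeries_mul_eq_zero hy, map_sum, Finset.sum_mul,
    IsLinearSolution]
  simp only [h.iterate, map_mul, mul_assoc]

theorem HasQuotient.block_eq_riccatiClass {u₀ : RatFunc L} {y₀ : GenSeries L} (hy₀ : y₀ ≠ 0)
    (h₀ : HasQuotient E u₀ y₀) :
    {u | ∃ y ∈ hypergeometricSolutions L E, Similar y y₀ ∧ HasQuotient E u y} =
      riccatiClass E u₀ := by
  ext u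
  constructor
  · rintro ⟨y, ⟨hy, hlin, -⟩, ⟨q, hq, rfl⟩, hu⟩
    exact ⟨(hu.isLinearSolution_iff hy).1 hlin, q, hq, hu.unique hy (h₀.ratToGenSeries_mul hq)⟩
  · rintro ⟨hu, q, hq, rfl⟩
    have hy : ratToGenSeries L q * y₀ ≠ 0 := (ratToGenSeries_mul_eq_zero hy₀).not.2 hq
    have hquot := h₀.ratToGenSeries_mul hq
    exact ⟨_, ⟨hy, (hquot.isLinearSolution_iff hy).2 hu, _, hquot⟩, ⟨q, hq, rfl⟩, hquot⟩

variable (E L) in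
theorem blocks_eq_image_riccatiClass : blocks L E = riccatiClass E '' E.riccatiSolutions L := by
  ext 𝔅
  constructor
  · rintro ⟨y₀, ⟨hy₀, hlin, u₀, h₀⟩, rfl⟩
    exact ⟨u₀, (h₀.isLinearSolution_iff hy₀).1 hlin, (h₀.block_eq_riccatiClass hy₀).symm⟩
  · rintro ⟨u₀, hu₀, rfl⟩
    obtain ⟨y₀, hy₀, h₀⟩ := exists_hasQuotient E (ne_zero_of_mem_riccatiSolutions E hu₀)
    exact ⟨y₀, ⟨hy₀, (h₀.isLinearSolution_iff hy₀).2 hu₀, u₀, h₀⟩,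
      (h₀.block_eq_riccatiClass hy₀).symm⟩

end Blocks

/-! ### The cleaning loop and the output -/

section Cleaning

theorem exists_reflTransGen_and_not_exists_of_acc {α : Type*} {r : α → α → Prop} {x : α}
    (h : Acc (fun y x => r x y) x) : ∃ z, Relation.ReflTransGen r x z ∧ ¬ ∃ y, r z y := by
  induction h with
  | intro x _ ih =>
    by_cases hex : ∃ y, r x y
    · obtain ⟨y, hxy⟩ := hex
      obtain ⟨z, hyz, hz⟩ := ih y hxy
      exact ⟨z, hyz.head hxy, hz⟩
    · exact ⟨x, .refl, hex⟩

variable {L : Type*} [Field L] {𝒰 𝒱 : Set (Param L)}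

theorem CleaningStep.ssubset (h : CleaningStep 𝒰 𝒱) : 𝒱 ⊂ 𝒰 := by
  obtain ⟨p, hp, -, -, -, -, rfl⟩ := h
  exact ⟨Set.sdiff_subset, fun h => (h hp).2 rfl⟩

theorem CleaningStep.exists_image_subset (h : CleaningStep 𝒰 𝒱) {p : Param L} (hp : p ∈ 𝒰) :
    ∃ q ∈ 𝒱, p.image ⊆ q.image := by
  obtain ⟨p', -, q, hq, hne, himage, rfl⟩ := h
  rcases eq_or_ne p p' with rfl | hpp'
  · exact ⟨q, ⟨hq, hne.symm⟩, himage⟩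
  · exact ⟨p, ⟨hp, hpp'⟩, subset_rfl⟩

theorem subset_of_reflTransGen_cleaningStep (h : Relation.ReflTransGen CleaningStep 𝒰 𝒱) :
    𝒱 ⊆ 𝒰 := by
  induction h with
  | refl => exact subset_rfl
  | tail _ hstep ih => exact hstep.ssubset.subset.trans ih

theorem exists_image_subset_of_reflTransGen_cleaningStep
    (h : Relation.ReflTransGen CleaningStep 𝒰 𝒱) {p : Param L} (hp : p ∈ 𝒰) :
    ∃ q ∈ 𝒱, p.image ⊆ q.image := by
  induction h with
  | refl => exact ⟨p, hp, subset_rfl⟩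
  | tail _ hstep ih =>
    obtain ⟨q, hq, hpq⟩ := ih
    obtain ⟨q', hq', hqq'⟩ := hstep.exists_image_subset hq
    exact ⟨q', hq', hpq.trans hqq'⟩

theorem acc_cleaningStep (h : 𝒰.Finite) :
    Acc (fun 𝒰' 𝒰 : Set (Param L) => CleaningStep 𝒰 𝒰') 𝒰 := by
  induction hn : 𝒰.ncard using Nat.strong_induction_on generalizing 𝒰 with
  | _ n ih =>
    subst hn
    exact ⟨_, fun 𝒱 h𝒱 => ih _ (Set.ncard_lt_ncard h𝒱.ssubset h) (h.subset h𝒱.ssubset.subset) rfl⟩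

theorem Param.IsBijectiveParametrization.image_nonempty {p : Param L}
    (h : p.IsBijectiveParametrization) : p.image.Nonempty := by
  obtain ⟨hs, φ, hφ, -⟩ := h
  have hγ : (fun _ => 1 : Fin p.1 → L) ≠ 0 := fun h => one_ne_zero (congrFun h ⟨0, hs⟩)
  exact ⟨_, _, hγ, hφ _ hγ⟩

end Cleaning

section Output

variable {K : Type*} [Field K] {E : MahlerEquation K} {L : Type*} [Field L] [Algebra K L]
variable {β : BasisChoice E L} {p : Param L} {𝒰 : Set (Param L)}

variable (β) in
theorem finite_candidates : (candidates β).Finite := by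
  have := Iteration.finite E L
  choose u _ huniq using existsUnique_isIdentified β
  refine (Set.finite_range fun i : {i : Iteration E L // 0 < i.dim} =>
    (⟨i.1.dim, u i.1 i.2⟩ : Param L)).subset ?_
  rintro _ ⟨i, v, hi, hv, rfl⟩
  exact ⟨⟨i, hi⟩, by rw [huniq i hi v hv]⟩

variable (E L) in
theorem terminates : Terminates E L :=
  ⟨Iteration.finite E L, fun i => i.finite_solSpace,
    ⟨fun i => Module.finBasis L i.solSpace⟩, existsUnique_isIdentified,
    fun β => acc_cleaningStep (finite_candidates β)⟩

variable (E L) in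
theorem exists_isOutput : ∃ 𝒰 : Set (Param L), IsOutput E L 𝒰 := by
  obtain ⟨-, -, ⟨β⟩, -, hacc⟩ := terminates E L
  obtain ⟨𝒰, h𝒰⟩ := exists_reflTransGen_and_not_exists_of_acc (hacc β)
  exact ⟨𝒰, β, h𝒰⟩

theorem isBijectiveParametrization_of_mem_candidates (hp : p ∈ candidates β) :
    p.IsBijectiveParametrization := by
  obtain ⟨i, u, hi, hu, rfl⟩ := hp
  exact isBijectiveParametrization hi hu

theorem exists_image_subset_riccatiClass (hp : p ∈ candidates β) :
    ∃ v ∈ E.riccatiSolutions L, p.image ⊆ riccatiClass E v := by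
  obtain ⟨v, hv⟩ := (isBijectiveParametrization_of_mem_candidates hp).image_nonempty
  obtain ⟨i, u, -, hu, rfl⟩ := hp
  rw [image_eq_values hu] at hv ⊢
  exact ⟨v, i.values_subset_riccatiSolutions hv, Iteration.values_subset_riccatiClass hv⟩

theorem exists_mem_candidates_image_eq [Infinite L] (β : BasisChoice E L) {u₀ : RatFunc L}
    (hu₀ : u₀ ∈ E.riccatiSolutions L) : ∃ p ∈ candidates β, p.image = riccatiClass E u₀ := by
  obtain ⟨i, hi⟩ := exists_values_eq_riccatiClass hu₀
  obtain ⟨c, hc, hc₀, -⟩ : u₀ ∈ i.values := hi ▸ mem_riccatiClass_self E hu₀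
  have : Nontrivial i.solSpace := nontrivial_of_ne ⟨c, hc⟩ 0 (Subtype.coe_ne_coe.1 hc₀)
  have hdim : 0 < i.dim := Module.finrank_pos
  obtain ⟨u, hu, -⟩ := existsUnique_isIdentified β i hdim
  exact ⟨_, ⟨i, u, hdim, hu, rfl⟩, (image_eq_values hu).trans hi⟩

theorem IsOutput.finite (h : IsOutput E L 𝒰) : 𝒰.Finite := by
  obtain ⟨β, hβ, -⟩ := h
  exact (finite_candidates β).subset (subset_of_reflTransGen_cleaningStep hβ)

theorem IsOutput.isBijectiveParametrization (h : IsOutput E L 𝒰) (hp : p ∈ 𝒰) :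
    p.IsBijectiveParametrization := by
  obtain ⟨β, hβ, -⟩ := h
  exact isBijectiveParametrization_of_mem_candidates (subset_of_reflTransGen_cleaningStep hβ hp)

theorem IsOutput.eq_of_image_subset (h : IsOutput E L 𝒰) {q : Param L} (hp : p ∈ 𝒰) (hq : q ∈ 𝒰)
    (hpq : p.image ⊆ q.image) : p = q := by
  obtain ⟨-, -, hterminal⟩ := h
  by_contra hne
  exact hterminal ⟨_, p, hp, q, hq, hne, hpq, rfl⟩

theorem IsOutput.exists_image_eq_riccatiClass [Infinite L] (h : IsOutput E L 𝒰) {u : RatFunc L}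
    (hu : u ∈ E.riccatiSolutions L) : ∃ p ∈ 𝒰, p.image = riccatiClass E u := by
  obtain ⟨β, hβ, -⟩ := h
  obtain ⟨p, hp, hpu⟩ := exists_mem_candidates_image_eq β hu
  obtain ⟨q, hq, hpq⟩ := exists_image_subset_of_reflTransGen_cleaningStep hβ hp
  obtain ⟨v, -, hqv⟩ :=
    exists_image_subset_riccatiClass (subset_of_reflTransGen_cleaningStep hβ hq)
  rw [hpu] at hpq
  have huv := riccatiClass_eq_of_mem E (hqv (hpq (mem_riccatiClass_self E hu)))
  exact ⟨q, hq, (huv ▸ hqv).antisymm hpq⟩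

theorem IsOutput.image_eq_riccatiClass [Infinite L] (h : IsOutput E L 𝒰) (hp : p ∈ 𝒰)
    {u : RatFunc L} (hu : u ∈ p.image) :
    u ∈ E.riccatiSolutions L ∧ p.image = riccatiClass E u := by
  have ⟨β, hβ, _⟩ := h
  obtain ⟨v, hv, hpv⟩ :=
    exists_image_subset_riccatiClass (subset_of_reflTransGen_cleaningStep hβ hp)
  obtain ⟨q, hq, hqv⟩ := h.exists_image_eq_riccatiClass hv
  obtain rfl := h.eq_of_image_subset hp hq (hqv ▸ hpv)
  exact ⟨(hpv hu).1, by rw [hqv, riccatiClass_eq_of_mem E (hpv hu)]⟩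

theorem IsOutput.image_mem_image_riccatiClass [Infinite L] (h : IsOutput E L 𝒰) (hp : p ∈ 𝒰) :
    p.image ∈ riccatiClass E '' E.riccatiSolutions L := by
  obtain ⟨u, hu⟩ := (h.isBijectiveParametrization hp).image_nonempty
  obtain ⟨hsol, himage⟩ := h.image_eq_riccatiClass hp hu
  exact ⟨u, hsol, himage.symm⟩

theorem IsOutput.pairwiseDisjoint [Infinite L] (h : IsOutput E L 𝒰) :
    𝒰.PairwiseDisjoint Param.image := by
  intro p hp q hq hpq
  refine Set.disjoint_left.2 fun u hup huq => hpq (h.eq_of_image_subset hp hq ?_)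
  rw [(h.image_eq_riccatiClass hp hup).2, (h.image_eq_riccatiClass hq huq).2]

theorem IsOutput.iUnion_image [Infinite L] (h : IsOutput E L 𝒰) :
    (⋃ p ∈ 𝒰, p.image) = E.riccatiSolutions L := by
  refine Set.Subset.antisymm
    (Set.iUnion₂_subset fun p hp u hu => (h.image_eq_riccatiClass hp hu).1) fun u hu => ?_
  obtain ⟨p, hp, hpu⟩ := h.exists_image_eq_riccatiClass hu
  exact Set.mem_biUnion hp (hpu ▸ mem_riccatiClass_self E hu)

theorem IsOutput.bijOn_image [Infinite L] (h : IsOutput E L 𝒰) :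
    Set.BijOn Param.image 𝒰 (blocks L E) := by
  rw [blocks_eq_image_riccatiClass]
  refine ⟨fun p hp => h.image_mem_image_riccatiClass hp,
    fun p hp q hq hpq => h.eq_of_image_subset hp hq hpq.subset, ?_⟩
  rintro _ ⟨u, hu, rfl⟩
  exact h.exists_image_eq_riccatiClass hu

end Output

end MahlerBP

end

theorem mainTheorem2_general {K : Type*} [Field K] (L : Type*) [Field L] [Algebra K L] [Infinite L]
    (E : MahlerBP.MahlerEquation K) :
    MahlerBP.Terminates E L ∧
    (∃ 𝒰 : Set (MahlerBP.Param L), MahlerBP.IsOutput E L 𝒰) ∧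
    ∀ 𝒰 : Set (MahlerBP.Param L), MahlerBP.IsOutput E L 𝒰 →
      𝒰.Finite ∧
      (∀ p ∈ 𝒰, p.IsBijectiveParametrization) ∧
      𝒰.PairwiseDisjoint MahlerBP.Param.image ∧
      (⋃ p ∈ 𝒰, p.image) = E.riccatiSolutions L ∧
      Set.BijOn MahlerBP.Param.image 𝒰 (MahlerBP.blocks L E) :=
  ⟨MahlerBP.terminates E L, MahlerBP.exists_isOutput E L, fun _ h =>
    ⟨h.finite, fun _ hp => h.isBijectiveParametrization hp, h.pairwiseDisjoint, h.iUnion_image,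
      h.bijOn_image⟩⟩

theorem mainTheorem2 {K : Type*} [Field K] [CharZero K] (L : Type*) [Field L] [Algebra K L]
    [Algebra.IsAlgebraic K L] (E : MahlerBP.MahlerEquation K) :
    MahlerBP.Terminates E L ∧
    (∃ 𝒰 : Set (MahlerBP.Param L), MahlerBP.IsOutput E L 𝒰) ∧
    ∀ 𝒰 : Set (MahlerBP.Param L), MahlerBP.IsOutput E L 𝒰 →
      𝒰.Finite ∧
      (∀ p ∈ 𝒰, p.IsBijectiveParametrization) ∧
      𝒰.PairwiseDisjoint MahlerBP.Param.image ∧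
      (⋃ p ∈ 𝒰, p.image) = E.riccatiSolutions L ∧
      Set.BijOn MahlerBP.Param.image 𝒰 (MahlerBP.blocks L E) := by
  have := charZero_of_injective_algebraMap (algebraMap K L).injective
  exact mainTheorem2_general L E
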